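/- Let $p,q\ge 2$ be integers, and let $O(p)\times O(q)$ act on the unit sphere $\mathbb{S}^{p+q-1}\subset\mathbb{R}^p\times\mathbb{R}^q$ by $(A,B)\cdot(x,y)=(Ax,By)$. There exists a family $h(t)$, $t\in(0,1]$, of smooth Riemannian metrics on $\mathbb{S}^{p+q-1}$, continuous in $t$ with respect to the $C^\infty$ topology (in local charts, every derivative of the metric coefficients is jointly continuous in $t$ and the point), such that every $h(t)$ is invariant under the action of $O(p)\times O(q)$ and the following hold. (i) For every $t\in(0,1]$ the curvature operator satisfies $\mathrm{Rm}(h(t))\ge 1$, that is, $\langle \mathrm{Rm}(\omega),\omega\rangle\ge\langle\omega,\omega\rangle$ for every bivector $\omega$ at every point, where $\mathrm{Rm}$ is normalised to be the identity for the round unit sphere. (ii) As $t\downarrow 0$, the metric spaces $(\mathbb{S}^{p+q-1},d_{h(t)})$, where $d_{h(t)}$ is the Riemannian distance of $h(t)$, converge in the Gromov–Hausdorff sense to the closed hemisphere $\mathbb{S}^p_+=\{x\in\mathbb{R}^{p+1}:|x|=1,\ x_0\ge 0\}$ with the intrinsic distance of the round metric of curvature $1$. -/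

import Mathlib

open Set Filter Topology
open scoped Manifold ContDiff Bundle

noncomputable section

/-! ## Smooth Riemannian metrics -/

/-- Smooth Riemannian metrics on a (boundaryless) smooth manifold `M` modelled on the vector
space `E`: smooth positive definite symmetric 2-tensors, in the sense of Mathlib. -/
abbrev SmoothMetric (E : Type*) [NormedAddCommGroup E] [NormedSpace ℝ E]
    (M : Type*) [TopologicalSpace M] [ChartedSpace E M] [IsManifold 𝓘(ℝ, E) ∞ M] :=
  Bundle.ContMDiffRiemannianMetric 𝓘(ℝ, E) ∞ E (fun x : M ↦ TangentSpace 𝓘(ℝ, E) x)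

/-! ## Coordinate calculus for a metric on an open set of a vector space -/

/-- The Christoffel symbols of a metric `G` (a field of bilinear forms on `E`) at the point `y`:
`Γ(a, b)` is the vector with
`G(Γ(a, b), c) = 1/2 (∂_a G(b, c) + ∂_b G(a, c) - ∂_c G(a, b))` for all `c`.
Here `(G y).inverse` raises the index. -/
def christoffel {E : Type*} [NormedAddCommGroup E] [NormedSpace ℝ E]
    (G : E → E →L[ℝ] E →L[ℝ] ℝ) (y a b : E) : E :=
  (G y).inverse ((1 / 2 : ℝ) •
    (fderiv ℝ G y a b + fderiv ℝ G y b a - ((fderiv ℝ G y).flip a).flip b))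

/-- The Riemann curvature tensor of a metric `G` at the point `y`, on constant vector fields:
`R(a, b) c = ∇_a ∇_b c - ∇_b ∇_a c`
`= ∂_a (Γ(b, c)) - ∂_b (Γ(a, c)) + Γ(a, Γ(b, c)) - Γ(b, Γ(a, c))`. -/
def riemannTensor {E : Type*} [NormedAddCommGroup E] [NormedSpace ℝ E]
    (G : E → E →L[ℝ] E →L[ℝ] ℝ) (y a b c : E) : E :=
  fderiv ℝ (fun z ↦ christoffel G z b c) y a - fderiv ℝ (fun z ↦ christoffel G z a c) y b
    + christoffel G y a (christoffel G y b c) - christoffel G y b (christoffel G y a c)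

/-- All eigenvalues of the curvature operator of `G` at `y` are at least `κ`, that is
`⟨Rm ω, ω⟩ ≥ κ ⟨ω, ω⟩` for every bivector `ω = ∑ i, X i ∧ Y i`, where
`⟨Rm (a ∧ b), c ∧ d⟩ = G(R(a, b) d, c)` and
`⟨a ∧ b, c ∧ d⟩ = G(a, c) G(b, d) - G(a, d) G(b, c)`; with these signs the curvature operator
of the unit sphere is the identity. -/
def CurvatureOperatorGEAt {E : Type*} [NormedAddCommGroup E] [NormedSpace ℝ E]
    (G : E → E →L[ℝ] E →L[ℝ] ℝ) (κ : ℝ) (y : E) : Prop :=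
  ∀ (m : ℕ) (X Y : Fin m → E),
    κ * ∑ i, ∑ j, (G y (X i) (X j) * G y (Y i) (Y j) - G y (X i) (Y j) * G y (Y i) (X j))
      ≤ ∑ i, ∑ j, G y (riemannTensor G y (X i) (Y i) (Y j)) (X j)

/-! ## Geometry of a smooth metric on a manifold -/

namespace SmoothMetric

/-- The metric `g` read in the preferred chart at `x`, as a field of bilinear forms on the model
space: the pullback of `g` under the inverse of the chart. -/
def inChart {E : Type*} [NormedAddCommGroup E] [NormedSpace ℝ E]
    {M : Type*} [TopologicalSpace M] [ChartedSpace E M] [IsManifold 𝓘(ℝ, E) ∞ M]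
    (g : SmoothMetric E M) (x : M) (y : E) : E →L[ℝ] E →L[ℝ] ℝ :=
  let B : E →L[ℝ] E →L[ℝ] ℝ := g.inner ((extChartAt 𝓘(ℝ, E) x).symm y)
  let D : E →L[ℝ] E := mfderiv 𝓘(ℝ, E) 𝓘(ℝ, E) (extChartAt 𝓘(ℝ, E) x).symm y
  B.bilinearComp D D

/-- `Rm(g) ≥ κ`: at every point `x`, all eigenvalues of the curvature operator of `g` are at least
`κ`. The curvature at `x`, a tensor, is computed in the preferred chart at `x`. -/
def CurvatureOperatorGE {E : Type*} [NormedAddCommGroup E] [NormedSpace ℝ E]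
    {M : Type*} [TopologicalSpace M] [ChartedSpace E M] [IsManifold 𝓘(ℝ, E) ∞ M]
    (g : SmoothMetric E M) (κ : ℝ) : Prop :=
  ∀ x : M, CurvatureOperatorGEAt (g.inChart x) κ (extChartAt 𝓘(ℝ, E) x x)

/-- The family `h t`, `t ∈ T`, of smooth metrics is continuous in the topology of smooth
convergence (locally uniform convergence of all derivatives of the metric coefficients): in the
charts, every derivative of the metric coefficients is jointly continuous in the parameter and
the point. -/
def ContinuousFamilyOn {E : Type*} [NormedAddCommGroup E] [NormedSpace ℝ E]
    {M : Type*} [TopologicalSpace M] [ChartedSpace E M] [IsManifold 𝓘(ℝ, E) ∞ M]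
    (h : ℝ → SmoothMetric E M) (T : Set ℝ) : Prop :=
  ∀ (x : M) (k : ℕ),
    ContinuousOn (fun z : ℝ × E ↦ iteratedFDeriv ℝ k ((h z.1).inChart x) z.2)
      (T ×ˢ (extChartAt 𝓘(ℝ, E) x).target)

/-- The self-map `Φ` of `M` preserves the metric `g`, that is `Φ^* g = g`. -/
def IsPreservedBy {E : Type*} [NormedAddCommGroup E] [NormedSpace ℝ E]
    {M : Type*} [TopologicalSpace M] [ChartedSpace E M] [IsManifold 𝓘(ℝ, E) ∞ M]
    (g : SmoothMetric E M) (Φ : M → M) : Prop :=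
  ∀ (x : M) (v w : TangentSpace 𝓘(ℝ, E) x),
    g.inner (Φ x) (mfderiv 𝓘(ℝ, E) 𝓘(ℝ, E) Φ x v) (mfderiv 𝓘(ℝ, E) 𝓘(ℝ, E) Φ x w)
      = g.inner x v w

/-- The extended distance of a smooth metric: the infimum of the lengths of `C^1` paths. -/
abbrev emetricSpace {E : Type*} [NormedAddCommGroup E] [NormedSpace ℝ E] [FiniteDimensional ℝ E]
    {M : Type*} [TopologicalSpace M] [T3Space M] [ChartedSpace E M] [IsManifold 𝓘(ℝ, E) ∞ M]
    (g : SmoothMetric E M) : EMetricSpace M :=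
  letI : Bundle.RiemannianBundle (fun x : M ↦ TangentSpace 𝓘(ℝ, E) x) :=
    ⟨g.toContinuousRiemannianMetric.toRiemannianMetric⟩
  EMetricSpace.ofRiemannianMetric 𝓘(ℝ, E) M

theorem edist_ne_top {E : Type*} [NormedAddCommGroup E] [NormedSpace ℝ E] [FiniteDimensional ℝ E]
    {M : Type*} [TopologicalSpace M] [T3Space M] [PreconnectedSpace M] [ChartedSpace E M]
    [IsManifold 𝓘(ℝ, E) ∞ M] (g : SmoothMetric E M) (x y : M) :
    g.emetricSpace.edist x y ≠ ⊤ := by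
  let := g.emetricSpace
  have hc : IsClopen (Metric.eball x (⊤ : ENNReal)) :=
    ⟨Metric.isClosed_eball_top, Metric.isOpen_eball⟩
  have hu := hc.eq_univ ⟨x, by simp⟩
  have hy : y ∈ Metric.eball x (⊤ : ENNReal) := by rw [hu]; trivial
  have h2 : edist y x < ⊤ := hy
  rw [edist_comm] at h2
  exact h2.ne

/-- The Riemannian distance of a smooth metric on a connected manifold. -/
abbrev metricSpace {E : Type*} [NormedAddCommGroup E] [NormedSpace ℝ E] [FiniteDimensional ℝ E]
    {M : Type*} [TopologicalSpace M] [T3Space M] [PreconnectedSpace M] [ChartedSpace E M]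
    [IsManifold 𝓘(ℝ, E) ∞ M] (g : SmoothMetric E M) : MetricSpace M :=
  letI := g.emetricSpace
  EMetricSpace.toMetricSpace g.edist_ne_top

/-- The closed connected Riemannian manifold `(M, g)`, with its Riemannian distance, as a point of
the Gromov–Hausdorff space (the metric space of isometry classes of nonempty compact metric spaces,
with the Gromov–Hausdorff distance). -/
def toGHSpace {E : Type*} [NormedAddCommGroup E] [NormedSpace ℝ E] [FiniteDimensional ℝ E]
    {M : Type*} [TopologicalSpace M] [T3Space M] [ConnectedSpace M] [hM : CompactSpace M]
    [ChartedSpace E M] [IsManifold 𝓘(ℝ, E) ∞ M] (g : SmoothMetric E M) :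
    GromovHausdorff.GHSpace :=
  letI := g.metricSpace
  haveI : CompactSpace M := hM
  GromovHausdorff.toGHSpace M

end SmoothMetric

/-! ## The sphere with the action of `O(p) × O(q)` -/

/-- `ℝ^{p+q} = ℝ^p × ℝ^q` with the Euclidean norm. -/
abbrev SplitSpace (p q : ℕ) : Type :=
  WithLp 2 (EuclideanSpace ℝ (Fin p) × EuclideanSpace ℝ (Fin q))

/-- The unit sphere `S^{p+q-1}` of `ℝ^p × ℝ^q`, with Mathlib's smooth structure. -/
abbrev SplitSphere (p q : ℕ) : Type := Metric.sphere (0 : SplitSpace p q) 1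

theorem finrank_splitSpace (p q : ℕ) : Module.finrank ℝ (SplitSpace p q) = p + q := by
  rw [LinearEquiv.finrank_eq (WithLp.linearEquiv 2 ℝ
    (EuclideanSpace ℝ (Fin p) × EuclideanSpace ℝ (Fin q)))]
  simp

instance splitSpace_finrank_fact (p q : ℕ) [hp : Fact (2 ≤ p)] :
    Fact (Module.finrank ℝ (SplitSpace p q) = (p + q - 1) + 1) :=
  ⟨by have := hp.out; rw [finrank_splitSpace]; omega⟩

instance splitSphere_connectedSpace (p q : ℕ) [hp : Fact (2 ≤ p)] :
    ConnectedSpace (SplitSphere p q) := by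
  refine isConnected_iff_connectedSpace.1 (isConnected_sphere ?_ _ zero_le_one)
  have := hp.out
  rw [← Module.finrank_eq_rank, finrank_splitSpace]
  exact_mod_cast (by omega : 1 < p + q)

/-- The standard action of `(A, B) ∈ O(p) × O(q)` on the sphere: `(x, y) ↦ (A x, B y)`. -/
def splitAction {p q : ℕ} (A : EuclideanSpace ℝ (Fin p) ≃ₗᵢ[ℝ] EuclideanSpace ℝ (Fin p))
    (B : EuclideanSpace ℝ (Fin q) ≃ₗᵢ[ℝ] EuclideanSpace ℝ (Fin q)) (x : SplitSphere p q) :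
    SplitSphere p q :=
  ⟨LinearIsometryEquiv.withLpProdCongr 2 A B x, by
    rw [mem_sphere_zero_iff_norm, LinearIsometryEquiv.norm_map, norm_eq_of_mem_sphere]⟩

/-! ## The round hemisphere -/

/-- The closed unit hemisphere `S^p_+ = {x ∈ ℝ^{p+1} : |x| = 1, x_0 ≥ 0}`. -/
def Hemisphere (p : ℕ) : Type :=
  {x : EuclideanSpace ℝ (Fin (p + 1)) // ‖x‖ = 1 ∧ 0 ≤ x 0}

/-- The distance on the hemisphere is the intrinsic distance of the round metric of curvature `1`:
the angle between unit vectors. (The closed hemisphere is convex in the sphere, so that this is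
also its own length distance.) -/
instance hemisphere_metricSpace (p : ℕ) : MetricSpace (Hemisphere p) where
  dist x y := InnerProductGeometry.angle x.1 y.1
  dist_self x := InnerProductGeometry.angle_self (norm_ne_zero_iff.1 (by simp [x.2.1]))
  dist_comm x y := InnerProductGeometry.angle_comm x.1 y.1
  dist_triangle x y z :=
    InnerProductGeometry.angle_le_angle_add_angle x.1 y.1 z.1
  eq_of_dist_eq_zero := by
    intro x y hxy
    have h : Real.cos (InnerProductGeometry.angle x.1 y.1) = 1 := by
      rw [show InnerProductGeometry.angle x.1 y.1 = 0 from hxy, Real.cos_zero]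
    rw [InnerProductGeometry.cos_angle, x.2.1, y.2.1, mul_one, div_one] at h
    exact Subtype.ext ((inner_eq_one_iff_of_norm_eq_one x.2.1 y.2.1).1 h)

instance hemisphere_nonempty (p : ℕ) : Nonempty (Hemisphere p) :=
  ⟨⟨EuclideanSpace.single 0 1, by simp⟩⟩

instance hemisphere_compactSpace (p : ℕ) : CompactSpace (Hemisphere p) := by
  let S : Set (EuclideanSpace ℝ (Fin (p + 1))) := {x | ‖x‖ = 1 ∧ 0 ≤ x 0}
  have hS : IsCompact S := by
    refine (isCompact_sphere (0 : EuclideanSpace ℝ (Fin (p + 1))) 1).of_isClosed_subset ?_ ?_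
    · exact (isClosed_eq continuous_norm continuous_const).inter
        (isClosed_le continuous_const (EuclideanSpace.proj (𝕜 := ℝ) (0 : Fin (p + 1))).continuous)
    · intro x hx
      simpa using hx.1
  have : CompactSpace S := isCompact_iff_compactSpace.1 hS
  let f : S → Hemisphere p := fun x ↦ ⟨x.1, x.2⟩
  have hf : Continuous f := by
    refine continuous_iff_continuousAt.2 fun x ↦ tendsto_iff_dist_tendsto_zero.2 ?_
    have hx : (x : EuclideanSpace ℝ (Fin (p + 1))) ≠ 0 := norm_ne_zero_iff.1 (by simp [x.2.1])
    have h1 : ContinuousAt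
        (fun y : S ↦ InnerProductGeometry.angle (y : EuclideanSpace ℝ (Fin (p + 1))) x.1) x := by
      unfold InnerProductGeometry.angle
      refine Real.continuous_arccos.continuousAt.comp (ContinuousAt.div ?_ ?_ (by simpa using hx))
      · exact (continuous_subtype_val.inner continuous_const).continuousAt
      · exact (continuous_subtype_val.norm.mul continuous_const).continuousAt
    have h2 := h1.tendsto
    rwa [InnerProductGeometry.angle_self hx] at h2
  have hsurj : Function.Surjective f := fun y ↦ ⟨⟨y.1, y.2⟩, rfl⟩
  exact hsurj.compactSpace hf

end

/-! In `ℝ^p × ℝ^q × ℝ`, let `Σ_t` be the part of the unit sphere where `z² = t|x|² + |y|²/t` and `z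
> 0`. The equivariant map `coneMap t` immerses `S^{p+q-1}` into `Σ_t`, and `h(t)` is the induced
metric.

Curvature: the form `t|x|² + |y|²/t - z²` is Lorentzian and `Σ_t` lies in its null cone. A
hyperplane tangent to the null cone is orthogonal to a null vector, so the form is positive
semidefinite on it. Hence `Σ_t` is a locally convex hypersurface of the unit sphere, and the Gauss
equation writes its curvature operator as the identity plus `Λ²` of a nonnegative form. This is
`inner_riemannTensor`, `curvatureOperatorGEAt_one_of_cone` and `inner_coneForm_coneMapDeriv`. No
curvature of an explicit metric is ever computed.

Limit: as `t → 0`, `coneMap t` tends to `(x, y) ↦ (x, 0, |y|)`, which is the quotient by `O(q)` with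
image a round hemisphere. Distances are compared with angles there. From above
(`edist_coneMetric_le`), `coneMap t` shortens curves of the round sphere, and, since `q ≥ 2`, any
two points of an `O(q)`-orbit are joined by an arc of length at most `√t π`. From below
(`angle_flatten_le_edist_coneMetric`), folding `(y, z)` to its norm is 1-Lipschitz, maps `Σ_t` into
the unit sphere of `ℝ^{p+1}`, and moves `coneMap t` to within angle `arccos (1/√(1+t))` of the
quotient map. So the quotient map has distortion at most `√t π + 2 arccos (1/√(1+t))`, which bounds
twice the Gromov–Hausdorff distance. -/

noncomputable section

/-! ## The Gauss equation for an immersion into a Euclidean space -/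

section Gauss

variable {E : Type*} [NormedAddCommGroup E] [NormedSpace ℝ E]
  {V : Type*} [NormedAddCommGroup V] [InnerProductSpace ℝ V]

set_option synthInstance.maxHeartbeats 200000 in
theorem contDiff_flip {F G : Type*} [NormedAddCommGroup F] [NormedSpace ℝ F]
    [NormedAddCommGroup G] [NormedSpace ℝ G] {n : ℕ∞ω} :
    ContDiff ℝ n (fun f : E →L[ℝ] F →L[ℝ] G ↦ f.flip) :=
  LinearIsometryEquiv.contDiff (𝕜 := ℝ) (E := E →L[ℝ] F →L[ℝ] G) (F := F →L[ℝ] E →L[ℝ] G)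
    (ContinuousLinearMap.flipₗᵢ ℝ E F G)

/-- The pullback of the inner product of `V` under a linear map. -/
def inducedForm (T : E →L[ℝ] V) : E →L[ℝ] E →L[ℝ] ℝ :=
  ContinuousLinearMap.bilinearComp (innerSL ℝ : V →L[ℝ] V →L[ℝ] ℝ) T T

@[simp] theorem inducedForm_apply (T : E →L[ℝ] V) (v w : E) :
    inducedForm T v w = inner ℝ (T v) (T w) := rfl

theorem contDiff_inducedForm {n : ℕ∞ω} :
    ContDiff ℝ n (inducedForm : (E →L[ℝ] V) → E →L[ℝ] E →L[ℝ] ℝ) := by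
  have h1 : ContDiff ℝ n (fun T : E →L[ℝ] V ↦ (innerSL ℝ : V →L[ℝ] V →L[ℝ] ℝ) ∘L T) :=
    contDiff_const.clm_comp contDiff_id
  have h2 := contDiff_flip.comp h1
  have h3 := h2.clm_comp (contDiff_id (𝕜 := ℝ) (E := E →L[ℝ] V) (n := n))
  exact contDiff_flip.comp h3

/-- `christoffel` raises an index with `ContinuousLinearMap.inverse`, which has a default value off
the invertible maps; injectivity of `T` rules that case out. -/
theorem isInvertible_inducedForm [FiniteDimensional ℝ E] {T : E →L[ℝ] V}
    (hT : Function.Injective T) : (inducedForm T).IsInvertible := by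
  have hinj : Function.Injective (inducedForm T : E →ₗ[ℝ] E →L[ℝ] ℝ) := by
    rw [injective_iff_map_eq_zero]
    intro v hv
    have h : inducedForm T v v = 0 := by
      rw [show inducedForm T v = 0 from hv]; rfl
    rw [inducedForm_apply, inner_self_eq_zero] at h
    exact hT (by rw [h, map_zero])
  have hdim : Module.finrank ℝ E = Module.finrank ℝ (E →L[ℝ] ℝ) := by
    rw [← (LinearMap.toContinuousLinearMap (𝕜 := ℝ) (E := E) (F' := ℝ)).finrank_eq,
      Module.finrank_linearMap, Module.finrank_self, mul_one]
  exact ⟨(LinearMap.linearEquivOfInjective _ hinj hdim).toContinuousLinearEquiv, by ext; rfl⟩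

/-- The second derivative of `Ψ` at `y` along constant vector fields. -/
abbrev hess (Ψ : E → V) (y a b : E) : V := fderiv ℝ (fderiv ℝ Ψ) y a b

variable {Ψ : E → V} (hΨ : ContDiff ℝ ∞ Ψ)
include hΨ

theorem fderiv_inducedForm (y a b c : E) :
    fderiv ℝ (fun z ↦ inducedForm (fderiv ℝ Ψ z)) y a b c =
      inner ℝ (hess Ψ y a b) (fderiv ℝ Ψ y c) + inner ℝ (fderiv ℝ Ψ y b) (hess Ψ y a c) := by
  have hd : ContDiff ℝ ∞ (fderiv ℝ Ψ) := hΨ.fderiv_right (by simp)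
  have hG : ContDiff ℝ ∞ (fun z ↦ inducedForm (fderiv ℝ Ψ z)) := contDiff_inducedForm.comp hd
  have hdd : DifferentiableAt ℝ (fderiv ℝ Ψ) y := hd.differentiable (by simp) y
  have hGd : DifferentiableAt ℝ (fun z ↦ inducedForm (fderiv ℝ Ψ z)) y :=
    hG.differentiable (by simp) y
  have e1 := fderiv_clm_apply (hGd.clm_apply (differentiableAt_const b)) (differentiableAt_const c)
  have e2 := fderiv_clm_apply hGd (differentiableAt_const b)
  have e3 : fderiv ℝ (fun z ↦ inducedForm (fderiv ℝ Ψ z) b c) y a =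
      fderiv ℝ (fun z ↦ inducedForm (fderiv ℝ Ψ z)) y a b c := by
    rw [e1, e2]; simp
  rw [← e3]
  simp only [inducedForm_apply]
  rw [fderiv_inner_apply ℝ (hdd.clm_apply (differentiableAt_const b))
    (hdd.clm_apply (differentiableAt_const c)), fderiv_clm_apply hdd (differentiableAt_const b),
    fderiv_clm_apply hdd (differentiableAt_const c)]
  simp [add_comm]

theorem hess_symm (y a b : E) : hess Ψ y a b = hess Ψ y b a :=
  (hΨ.contDiffAt.isSymmSndFDerivAt (by
    rw [minSmoothness_of_isRCLikeNormedField]; exact WithTop.coe_le_coe.2 le_top)).eq a b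

variable [FiniteDimensional ℝ E]

/-- Koszul's formula: in the three derivatives of the metric, symmetry of the Hessian cancels
everything but one term. So the Christoffel vector represents the tangential part of the Hessian of
`Ψ`. -/
theorem inner_christoffel {y : E} (hy : Function.Injective (fderiv ℝ Ψ y)) (a b c : E) :
    inner ℝ (fderiv ℝ Ψ y (christoffel (fun z ↦ inducedForm (fderiv ℝ Ψ z)) y a b))
      (fderiv ℝ Ψ y c) = inner ℝ (hess Ψ y a b) (fderiv ℝ Ψ y c) := by
  rw [← inducedForm_apply, christoffel, (isInvertible_inducedForm hy).self_apply_inverse]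
  simp only [smul_apply, sub_apply,
    add_apply, ContinuousLinearMap.flip_apply, fderiv_inducedForm hΨ]
  rw [hess_symm hΨ y b a, hess_symm hΨ y c a, hess_symm hΨ y c b,
    real_inner_comm (fderiv ℝ Ψ y b) (hess Ψ y a c),
    smul_eq_mul]
  ring

-- Inversion is smooth at an invertible form. This is what gives meaning to the derivative of the
-- Christoffel symbols in `riemannTensor`.
set_option synthInstance.maxHeartbeats 200000 in
theorem differentiableAt_christoffel {y : E} (hy : Function.Injective (fderiv ℝ Ψ y)) (b c : E) :
    DifferentiableAt ℝ (fun z ↦ christoffel (fun z ↦ inducedForm (fderiv ℝ Ψ z)) z b c) y := by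
  have hd : ContDiff ℝ ∞ (fderiv ℝ Ψ) := hΨ.fderiv_right (by simp)
  have hG : ContDiff ℝ ∞ (fun z ↦ inducedForm (fderiv ℝ Ψ z)) := contDiff_inducedForm.comp hd
  have hG' := hG.fderiv_right (m := 1) (by norm_cast)
  have : CompleteSpace E := FiniteDimensional.complete ℝ E
  have hinv : ContDiffAt ℝ 1 (fun z ↦ (inducedForm (fderiv ℝ Ψ z)).inverse) y :=
    (isInvertible_inducedForm hy).contDiffAt_map_inverse.comp y (hG.of_le (by simp)).contDiffAt
  have h1 : ContDiff ℝ 1 fun z ↦ (1 / 2 : ℝ) •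
      (fderiv ℝ (fun z ↦ inducedForm (fderiv ℝ Ψ z)) z b c
        + fderiv ℝ (fun z ↦ inducedForm (fderiv ℝ Ψ z)) z c b
        - ((fderiv ℝ (fun z ↦ inducedForm (fderiv ℝ Ψ z)) z).flip b).flip c) := by
    refine ContDiff.const_smul _ (((hG'.clm_apply contDiff_const).clm_apply contDiff_const).add
      ((hG'.clm_apply contDiff_const).clm_apply contDiff_const) |>.sub ?_)
    have h2 := (contDiff_flip.comp hG').clm_apply
      (contDiff_const (c := b))
    exact (contDiff_flip.comp h2).clm_apply (contDiff_const (c := c))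
  exact (hinv.clm_apply h1.contDiffAt).differentiableAt (by simp)

/-- The second fundamental form of the immersion `Ψ`. -/
def secondFF (Ψ : E → V) (y a b : E) : V :=
  hess Ψ y a b - fderiv ℝ Ψ y (christoffel (fun z ↦ inducedForm (fderiv ℝ Ψ z)) y a b)

theorem inner_secondFF {y : E} (hy : Function.Injective (fderiv ℝ Ψ y)) (a b c : E) :
    inner ℝ (secondFF Ψ y a b) (fderiv ℝ Ψ y c) = 0 := by
  rw [secondFF, inner_sub_left, inner_christoffel hΨ hy, sub_self]

/-- Differentiate `inner_christoffel` along `a`. The terms where the derivative hits the last factor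
combine into a product of normal parts. The remaining third derivative is symmetric in `a`, `b` and
will cancel on antisymmetrising. -/
theorem inner_fderiv_christoffel_add {y : E} (hy : ∀ z, Function.Injective (fderiv ℝ Ψ z))
    (a b c d : E) :
    inner ℝ (fderiv ℝ Ψ y
        (fderiv ℝ (fun z ↦ christoffel (fun z ↦ inducedForm (fderiv ℝ Ψ z)) z b c) y a
          + christoffel (fun z ↦ inducedForm (fderiv ℝ Ψ z)) y a
            (christoffel (fun z ↦ inducedForm (fderiv ℝ Ψ z)) y b c))) (fderiv ℝ Ψ y d)
      = inner ℝ (fderiv ℝ (fun z ↦ hess Ψ z b c) y a) (fderiv ℝ Ψ y d)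
        + inner ℝ (secondFF Ψ y b c) (secondFF Ψ y a d) := by
  have hd : ContDiff ℝ ∞ (fderiv ℝ Ψ) := hΨ.fderiv_right (by simp)
  have hdd : DifferentiableAt ℝ (fderiv ℝ Ψ) y := hd.differentiable (by simp) y
  have hdh : DifferentiableAt ℝ (fun z ↦ hess Ψ z b c) y := by
    have h := hd.fderiv_right (m := 1) (by norm_cast)
    exact ((h.clm_apply contDiff_const).clm_apply contDiff_const).differentiable (by simp) y
  have hΓ := differentiableAt_christoffel hΨ (hy y) b c
  have key : (fun z ↦ inner ℝ (fderiv ℝ Ψ z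
      (christoffel (fun z ↦ inducedForm (fderiv ℝ Ψ z)) z b c)) (fderiv ℝ Ψ z d))
      = fun z ↦ inner ℝ (hess Ψ z b c) (fderiv ℝ Ψ z d) :=
    funext fun z ↦ inner_christoffel hΨ (hy z) b c d
  have key2 := congrArg (fun f ↦ fderiv ℝ f y a) key
  beta_reduce at key2
  rw [fderiv_inner_apply ℝ (hdd.clm_apply hΓ) (hdd.clm_apply (differentiableAt_const d)),
    fderiv_inner_apply ℝ hdh (hdd.clm_apply (differentiableAt_const d)),
    fderiv_clm_apply hdd hΓ, fderiv_clm_apply hdd (differentiableAt_const d)] at key2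
  simp only [add_apply, ContinuousLinearMap.comp_apply,
    ContinuousLinearMap.flip_apply, fderiv_fun_const, Pi.zero_apply, map_zero, zero_add,
    zero_apply, inner_add_left] at key2
  have e1 := inner_christoffel hΨ (hy y) a
    (christoffel (fun z ↦ inducedForm (fderiv ℝ Ψ z)) y b c) d
  have e2 : inner ℝ (secondFF Ψ y b c) (secondFF Ψ y a d) =
      inner ℝ (hess Ψ y b c) (hess Ψ y a d) - inner ℝ (fderiv ℝ Ψ y
        (christoffel (fun z ↦ inducedForm (fderiv ℝ Ψ z)) y b c)) (hess Ψ y a d) := by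
    conv_lhs => rw [secondFF.eq_def Ψ y a d, inner_sub_right, inner_secondFF hΨ (hy y), sub_zero,
      secondFF, inner_sub_left]
  rw [map_add, inner_add_left, e1, e2]
  simp only [hess] at *
  linarith

/-- **Gauss equation**. -/
theorem inner_riemannTensor {y : E} (hy : ∀ z, Function.Injective (fderiv ℝ Ψ z)) (a b c d : E) :
    inducedForm (fderiv ℝ Ψ y) (riemannTensor (fun z ↦ inducedForm (fderiv ℝ Ψ z)) y a b c) d
      = inner ℝ (secondFF Ψ y b c) (secondFF Ψ y a d)
        - inner ℝ (secondFF Ψ y a c) (secondFF Ψ y b d) := by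
  have hd : ContDiff ℝ ∞ (fderiv ℝ Ψ) := hΨ.fderiv_right (by simp)
  have hc : ContDiff ℝ ∞ (fun z ↦ fderiv ℝ Ψ z c) := hd.clm_apply contDiff_const
  have hsymm : fderiv ℝ (fun z ↦ hess Ψ z b c) y a = fderiv ℝ (fun z ↦ hess Ψ z a c) y b := by
    have hcd : DifferentiableAt ℝ (fderiv ℝ (fun z ↦ fderiv ℝ Ψ z c)) y :=
      (hc.fderiv_right (m := 1) (by norm_cast)).differentiable (by simp) y
    have e : ∀ v, (fun z ↦ hess Ψ z v c) = fun z ↦ fderiv ℝ (fun z ↦ fderiv ℝ Ψ z c) z v := by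
      intro v
      funext z
      rw [fderiv_clm_apply (hd.differentiable (by simp) z) (differentiableAt_const c)]
      simp
    rw [e a, e b, fderiv_clm_apply hcd (differentiableAt_const a),
      fderiv_clm_apply hcd (differentiableAt_const b)]
    simpa using (hc.contDiffAt.isSymmSndFDerivAt (by
    rw [minSmoothness_of_isRCLikeNormedField]; exact WithTop.coe_le_coe.2 le_top)).eq a b
  have h1 := inner_fderiv_christoffel_add hΨ (y := y) hy a b c d
  have h2 := inner_fderiv_christoffel_add hΨ (y := y) hy b a c d
  rw [hsymm] at h1
  rw [inducedForm_apply, riemannTensor]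
  simp only [map_add, map_sub, inner_add_left, inner_sub_left] at h1 h2 ⊢
  linarith

end Gauss

/-! ## Curvature of convex hypersurfaces of the unit sphere -/

section Convex

-- The sum is half the squared norm of `∑ (ξ i ⊗ η i - η i ⊗ ξ i)`. It expresses that `Λ²` of a
-- nonnegative form is nonnegative.
open TensorProduct in
theorem sum_inner_wedge_nonneg {W : Type*} [NormedAddCommGroup W] [InnerProductSpace ℝ W]
    {ι : Type*} [Fintype ι] (ξ η : ι → W) :
    0 ≤ ∑ i, ∑ j, (inner ℝ (ξ i) (ξ j) * inner ℝ (η i) (η j)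
      - inner ℝ (ξ i) (η j) * inner ℝ (η i) (ξ j)) := by
  have h := real_inner_self_nonneg (x := ∑ i, (ξ i ⊗ₜ[ℝ] η i - η i ⊗ₜ[ℝ] ξ i))
  simp only [sum_inner, inner_sum, inner_sub_left, inner_sub_right,
    TensorProduct.inner_tmul] at h
  have e : ∀ i j, inner ℝ (ξ i) (ξ j) * inner ℝ (η i) (η j)
      - inner ℝ (η i) (ξ j) * inner ℝ (ξ i) (η j)
      - (inner ℝ (ξ i) (η j) * inner ℝ (η i) (ξ j)
        - inner ℝ (η i) (η j) * inner ℝ (ξ i) (ξ j))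
      = 2 * (inner ℝ (ξ i) (ξ j) * inner ℝ (η i) (η j)
        - inner ℝ (ξ i) (η j) * inner ℝ (η i) (ξ j)) := fun i j ↦ by ring
  simp only [← Finset.sum_sub_distrib, e, ← Finset.mul_sum] at h
  rw [Finset.sum_comm]
  linarith

variable {E : Type*} [NormedAddCommGroup E] [NormedSpace ℝ E] [FiniteDimensional ℝ E]
  {V : Type*} [NormedAddCommGroup V] [InnerProductSpace ℝ V] [FiniteDimensional ℝ V]
  {W : Type*} [NormedAddCommGroup W] [InnerProductSpace ℝ W]

/-- A vector orthogonal to a subspace of codimension two is determined by its components along two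
orthogonal normal vectors. -/
theorem eq_of_orthogonal_of_finrank {T : E →L[ℝ] V} (hT : Function.Injective T) {ν n u : V}
    (hdim : Module.finrank ℝ V = Module.finrank ℝ E + 2) (hν : ‖ν‖ = 1) (hn : n ≠ 0)
    (hνn : inner ℝ ν n = 0) (hνT : ∀ v, inner ℝ ν (T v) = 0) (hnT : ∀ v, inner ℝ n (T v) = 0)
    (hu : ∀ v, inner ℝ u (T v) = 0) :
    u = inner ℝ u ν • ν + (inner ℝ u n / ‖n‖ ^ 2) • n := by
  -- Orthogonality makes `L` injective, and the codimension count makes it onto; so `u` splits as a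
  -- tangential part plus multiples of `ν` and `n`.
  let L : E × ℝ × ℝ →ₗ[ℝ] V := (T : E →ₗ[ℝ] V).coprod
    ((LinearMap.toSpanSingleton ℝ V ν).coprod (LinearMap.toSpanSingleton ℝ V n))
  have hL : ∀ (v : E) (s r : ℝ), L (v, s, r) = T v + (s • ν + r • n) := fun v s r ↦ by simp [L]
  have hn2 : ‖n‖ ^ 2 ≠ 0 := by positivity
  have hTν : ∀ v, inner ℝ (T v) ν = 0 := fun v ↦ by rw [real_inner_comm, hνT]
  have hTn : ∀ v, inner ℝ (T v) n = 0 := fun v ↦ by rw [real_inner_comm, hnT]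
  have hnν : inner ℝ n ν = 0 := by rw [real_inner_comm, hνn]
  have i1 : ∀ (v : E) (s r : ℝ), inner ℝ (T v + (s • ν + r • n)) ν = s := fun v s r ↦ by
    simp [inner_add_left, inner_smul_left, hTν, hnν, hν]
  have i2 : ∀ (v : E) (s r : ℝ), inner ℝ (T v + (s • ν + r • n)) n = r * ‖n‖ ^ 2 := fun v s r ↦ by
    simp [inner_add_left, inner_smul_left, hTn, hνn]
  have hinj : Function.Injective L := by
    rw [injective_iff_map_eq_zero]
    rintro ⟨v, s, r⟩ h
    rw [hL] at h
    have h1 := i1 v s r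
    have h2 := i2 v s r
    rw [h, inner_zero_left] at h1 h2
    have hs : s = 0 := h1.symm
    have hr : r = 0 := by simpa [hn] using h2.symm
    subst hs hr
    have hv : v = 0 := hT (by simpa using h)
    rw [hv]; rfl
  have hsurj : Function.Surjective L :=
    (LinearMap.injective_iff_surjective_of_finrank_eq_finrank (by simp [hdim])).1 hinj
  obtain ⟨⟨v, s, r⟩, rfl⟩ := hsurj u
  rw [hL] at hu ⊢
  have h0 := hu v
  simp only [inner_add_left, inner_smul_left, hνT, hnT, mul_zero, add_zero,
    inner_self_eq_zero] at h0
  rw [i1, i2, mul_div_cancel_right₀ _ hn2, h0, zero_add]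

/-- Let `Ψ` be an immersed hypersurface of the unit sphere of `V` contained in the quadratic cone
`⟪N x, x⟫ = 0`, and assume that the quadratic form of `N` is nonnegative on its tangent space at
`Ψ y`. Then the curvature operator of the induced metric at `y` is at least `1`. -/
theorem curvatureOperatorGEAt_one_of_cone {Ψ : E → V} (hΨ : ContDiff ℝ ∞ Ψ)
    (himm : ∀ z, Function.Injective (fderiv ℝ Ψ z)) (hnorm : ∀ z, ‖Ψ z‖ = 1)
    (hdim : Module.finrank ℝ V = Module.finrank ℝ E + 2) (N : V →L[ℝ] V)
    (hN : ∀ u v, inner ℝ (N u) v = inner ℝ u (N v)) (hcone : ∀ z, inner ℝ (N (Ψ z)) (Ψ z) = 0)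
    {y : E} (hn : N (Ψ y) ≠ 0) (S : E → W)
    (hS : ∀ v w, inner ℝ (N (fderiv ℝ Ψ y v)) (fderiv ℝ Ψ y w) = inner ℝ (S v) (S w)) :
    CurvatureOperatorGEAt (fun z ↦ inducedForm (fderiv ℝ Ψ z)) 1 y := by
  have hd : ContDiff ℝ ∞ (fderiv ℝ Ψ) := hΨ.fderiv_right (by simp)
  have hdd : ∀ z, DifferentiableAt ℝ (fderiv ℝ Ψ) z := hd.differentiable (by simp)
  have hΨd : ∀ z, DifferentiableAt ℝ Ψ z := hΨ.differentiable (by simp)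
  have hNd : ∀ z, DifferentiableAt ℝ (fun z ↦ N (Ψ z)) z :=
    fun z ↦ N.differentiableAt.comp z (hΨd z)
  have hNf : ∀ z v, fderiv ℝ (fun z ↦ N (Ψ z)) z v = N (fderiv ℝ Ψ z v) := fun z v ↦ by
    rw [show (fun z ↦ N (Ψ z)) = N ∘ Ψ from rfl,
      (N.hasFDerivAt.comp z (hΨd z).hasFDerivAt).fderiv]; rfl
  have hf : ∀ z v w, fderiv ℝ (fun z ↦ fderiv ℝ Ψ z v) z w = hess Ψ z w v := fun z v w ↦ by
    rw [fderiv_clm_apply (hdd z) (differentiableAt_const v)]; simp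
  have hνT : ∀ z v, inner ℝ (Ψ z) (fderiv ℝ Ψ z v) = 0 := by
    intro z v
    have h : (fun z ↦ inner ℝ (Ψ z) (Ψ z)) = fun _ ↦ (1 : ℝ) := by
      funext z; rw [real_inner_self_eq_norm_sq, hnorm, one_pow]
    have h2 := congrArg (fun f ↦ fderiv ℝ f z v) h
    beta_reduce at h2
    rw [fderiv_inner_apply ℝ (hΨd z) (hΨd z), real_inner_comm (Ψ z)] at h2
    simp only [fderiv_fun_const, Pi.zero_apply, zero_apply] at h2
    linarith
  have hnT : ∀ z v, inner ℝ (N (Ψ z)) (fderiv ℝ Ψ z v) = 0 := by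
    intro z v
    have h2 := congrArg (fun f ↦ fderiv ℝ f z v) (funext hcone)
    beta_reduce at h2
    rw [fderiv_inner_apply ℝ (hNd z) (hΨd z), hNf, hN (fderiv ℝ Ψ z v), real_inner_comm (N (Ψ z))] at h2
    simp only [fderiv_fun_const, Pi.zero_apply, zero_apply] at h2
    linarith
  -- Differentiating `⟪Ψ, dΨ w⟫ = 0` gives the component along the position vector, responsible for
  -- the constant curvature 1; the same with `N Ψ` gives the component controlled by `S`.
  have h1 : ∀ v w, inner ℝ (secondFF Ψ y v w) (Ψ y) =
      -inner ℝ (fderiv ℝ Ψ y v) (fderiv ℝ Ψ y w) := by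
    intro v w
    have h2 := congrArg (fun f ↦ fderiv ℝ f y v) (funext fun z ↦ hνT z w)
    beta_reduce at h2
    rw [fderiv_inner_apply ℝ (hΨd y) ((hdd y).clm_apply (differentiableAt_const w)), hf] at h2
    simp only [fderiv_fun_const, Pi.zero_apply, zero_apply] at h2
    rw [secondFF, inner_sub_left, real_inner_comm (Ψ y) (fderiv ℝ Ψ y _), hνT,
      real_inner_comm (Ψ y)]
    linarith
  have h2 : ∀ v w, inner ℝ (secondFF Ψ y v w) (N (Ψ y)) = -inner ℝ (S v) (S w) := by
    intro v w
    have h2 := congrArg (fun f ↦ fderiv ℝ f y v) (funext fun z ↦ hnT z w)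
    beta_reduce at h2
    rw [fderiv_inner_apply ℝ (hNd y) ((hdd y).clm_apply (differentiableAt_const w)), hf,
      hNf, hS] at h2
    simp only [fderiv_fun_const, Pi.zero_apply, zero_apply] at h2
    rw [secondFF, inner_sub_left, real_inner_comm (N (Ψ y)) (fderiv ℝ Ψ y _), hnT,
      real_inner_comm (N (Ψ y))]
    linarith
  have hνn : inner ℝ (Ψ y) (N (Ψ y)) = 0 := by rw [real_inner_comm, hcone]
  have hII : ∀ v w, secondFF Ψ y v w = (-inner ℝ (fderiv ℝ Ψ y v) (fderiv ℝ Ψ y w)) • Ψ y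
      + (-inner ℝ (S v) (S w) / ‖N (Ψ y)‖ ^ 2) • N (Ψ y) := by
    intro v w
    conv_lhs => rw [eq_of_orthogonal_of_finrank (himm y) hdim (hnorm y) hn hνn (hνT y) (hnT y)
      (inner_secondFF hΨ (himm y) v w)]
    rw [h1, h2]
  -- The two normals are orthogonal, so the Gauss terms split into the unit-sphere part and a part
  -- built from the Gram form of `S`.
  have hII2 : ∀ a b c d, inner ℝ (secondFF Ψ y a b) (secondFF Ψ y c d) =
      inner ℝ (fderiv ℝ Ψ y a) (fderiv ℝ Ψ y b) * inner ℝ (fderiv ℝ Ψ y c) (fderiv ℝ Ψ y d)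
      + (‖N (Ψ y)‖ ^ 2)⁻¹ * (inner ℝ (S a) (S b) * inner ℝ (S c) (S d)) := by
    intro a b c d
    rw [hII c d, inner_add_right, inner_smul_right, inner_smul_right, h1, h2]
    ring
  intro m X Y
  have hR : ∀ i j, inducedForm (fderiv ℝ Ψ y)
      (riemannTensor (fun z ↦ inducedForm (fderiv ℝ Ψ z)) y (X i) (Y i) (Y j)) (X j)
      = (inducedForm (fderiv ℝ Ψ y) (X i) (X j) * inducedForm (fderiv ℝ Ψ y) (Y i) (Y j)
          - inducedForm (fderiv ℝ Ψ y) (X i) (Y j) * inducedForm (fderiv ℝ Ψ y) (Y i) (X j))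
        + (‖N (Ψ y)‖ ^ 2)⁻¹ * (inner ℝ (S (X i)) (S (X j)) * inner ℝ (S (Y i)) (S (Y j))
          - inner ℝ (S (X i)) (S (Y j)) * inner ℝ (S (Y i)) (S (X j))) := by
    intro i j
    rw [inner_riemannTensor hΨ himm, hII2, hII2]
    simp only [inducedForm_apply]
    ring
  simp only [hR, Finset.sum_add_distrib, ← Finset.mul_sum, one_mul]
  have h3 := sum_inner_wedge_nonneg (fun i ↦ S (X i)) (fun i ↦ S (Y i))
  have h4 : 0 ≤ (‖N (Ψ y)‖ ^ 2)⁻¹ := by positivity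
  linarith [mul_nonneg h4 h3]

end Convex

/-! ## The metric induced by an immersion into a Euclidean space -/

section Immersion

variable {E : Type*} [NormedAddCommGroup E] [NormedSpace ℝ E]
  {M : Type*} [TopologicalSpace M] [ChartedSpace E M]
  {V : Type*} [NormedAddCommGroup V] [InnerProductSpace ℝ V]

/-- The derivative at `x` of a map into a vector space, as a linear map between the models. -/
def modelDeriv (E : Type*) [NormedAddCommGroup E] [NormedSpace ℝ E]
    {M : Type*} [TopologicalSpace M] [ChartedSpace E M]
    {V : Type*} [NormedAddCommGroup V] [NormedSpace ℝ V] (f : M → V) (x : M) : E →L[ℝ] V :=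
  mfderiv 𝓘(ℝ, E) 𝓘(ℝ, V) f x

/-- The pullback of the inner product under the derivative of `f` at `x`. -/
def pullbackTensor (E : Type*) [NormedAddCommGroup E] [NormedSpace ℝ E]
    {M : Type*} [TopologicalSpace M] [ChartedSpace E M]
    {V : Type*} [NormedAddCommGroup V] [InnerProductSpace ℝ V] (f : M → V) (x : M) :
    TangentSpace 𝓘(ℝ, E) x →L[ℝ] TangentSpace 𝓘(ℝ, E) x →L[ℝ] ℝ :=
  letI B : E →L[ℝ] E →L[ℝ] ℝ := inducedForm (modelDeriv E f x)
  B

/-- A map read in the inverse of the preferred chart at `x`. -/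
def chartRep (E : Type*) [NormedAddCommGroup E] [NormedSpace ℝ E]
    {M : Type*} [TopologicalSpace M] [ChartedSpace E M]
    {V : Type*} (f : M → V) (x : M) (y : E) : V :=
  f ((extChartAt 𝓘(ℝ, E) x).symm y)

variable [IsManifold 𝓘(ℝ, E) ∞ M]

theorem contDiffAt_chartRep {f : M → V} (hf : ContMDiff 𝓘(ℝ, E) 𝓘(ℝ, V) ∞ f) {x : M} {y : E}
    (hy : y ∈ (extChartAt 𝓘(ℝ, E) x).target) : ContDiffAt ℝ ∞ (chartRep E f x) y := by
  rw [← contMDiffAt_iff_contDiffAt]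
  have h := (contMDiffOn_extChartAt_symm (I := 𝓘(ℝ, E)) (n := ∞) x).contMDiffAt
    ((isOpen_extChartAt_target x).mem_nhds hy)
  exact hf.contMDiffAt.comp y h

theorem fderiv_chartRep {f : M → V} (hf : ContMDiff 𝓘(ℝ, E) 𝓘(ℝ, V) ∞ f) {x : M} {y : E}
    (hy : y ∈ (extChartAt 𝓘(ℝ, E) x).target) :
    fderiv ℝ (chartRep E f x) y = (modelDeriv E f ((extChartAt 𝓘(ℝ, E) x).symm y)).comp
      (mfderiv 𝓘(ℝ, E) 𝓘(ℝ, E) (extChartAt 𝓘(ℝ, E) x).symm y : E →L[ℝ] E) := by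
  have h := (contMDiffOn_extChartAt_symm (I := 𝓘(ℝ, E)) (n := ∞) x).contMDiffAt
    ((isOpen_extChartAt_target x).mem_nhds hy)
  rw [← mfderiv_eq_fderiv]
  exact mfderiv_comp y (hf.mdifferentiable (by simp) _) (h.mdifferentiableAt (by simp))

open Bundle in
/-- The pullback of the Euclidean metric of `V` under an immersion `f`. -/
def SmoothMetric.ofImmersion [FiniteDimensional ℝ E] (f : M → V)
    (hf : ContMDiff 𝓘(ℝ, E) 𝓘(ℝ, V) ∞ f)
    (himm : ∀ x, Function.Injective (modelDeriv E f x)) : SmoothMetric E M where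
  inner x := pullbackTensor E f x
  symm x v w := real_inner_comm (F := V) _ _
  pos x v hv := (real_inner_self_pos (F := V)).2
    fun h ↦ hv (himm x (h.trans (map_zero (modelDeriv E f x)).symm))
  isVonNBounded x := by
    change Bornology.IsVonNBounded ℝ {v : E | inner ℝ (modelDeriv E f x v) (modelDeriv E f x v) < 1}
    -- An injective linear map on a finite-dimensional space is bounded below, so the unit ball of
    -- the pulled-back form is bounded.
    obtain ⟨K, hK, h⟩ := (modelDeriv E f x).toLinearMap.exists_antilipschitzWith
      (LinearMap.ker_eq_bot.2 (himm x))
    refine (NormedSpace.isVonNBounded_closedBall ℝ E K).subset fun v hv ↦ ?_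
    rw [mem_ofPred_eq, real_inner_self_eq_norm_sq] at hv
    have h1 : ‖v‖ ≤ K * ‖modelDeriv E f x v‖ := by
      simpa using h.le_mul_dist v 0
    have h2 : ‖modelDeriv E f x v‖ ≤ 1 := by nlinarith [norm_nonneg (modelDeriv E f x v)]
    rw [mem_closedBall_zero_iff]
    nlinarith [K.coe_nonneg]
  contMDiff := by
    -- In the tangent trivialization at `x`, the tensor is the pullback of the inner product by the
    -- derivative of `f` read in the chart, which is smooth.
    intro x
    rw [contMDiffAt_section]
    have hd : ContDiffAt ℝ ∞ (fun y ↦ inducedForm (fderiv ℝ (chartRep E f x) y))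
        (extChartAt 𝓘(ℝ, E) x x) :=
      contDiff_inducedForm.contDiffAt.comp _
        ((contDiffAt_chartRep hf (mem_extChartAt_target x)).fderiv_right (by simp))
    have h2 := hd.contMDiffAt.comp x (contMDiffAt_extChartAt (I := 𝓘(ℝ, E)) (n := ∞) (x := x))
    refine h2.congr_of_eventuallyEq ?_
    filter_upwards [(chartAt E x).open_source.mem_nhds (mem_chart_source E x)] with z hz
    have hz' : z ∈ (extChartAt 𝓘(ℝ, E) x).source := by rwa [extChartAt_source]
    ext v w
    simp only [Function.comp_apply]
    rw [hom_trivializationAt_apply]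
    have hb : z ∈ (trivializationAt E (TangentSpace 𝓘(ℝ, E) : M → Type _) x).baseSet := hz
    have key := inCoordinates_apply_eq₂ (F₁ := E) (F₂ := E) (F₃ := ℝ)
      (E₁ := fun x : M ↦ TangentSpace 𝓘(ℝ, E) x) (E₂ := fun x : M ↦ TangentSpace 𝓘(ℝ, E) x)
      (E₃ := fun _ : M ↦ ℝ) (x₀ := x) (x := z) (ϕ := pullbackTensor E f z)
      (v := v) (w := w) hb hb (by simp)
    refine key.trans ?_
    have hsymm : ∀ u : E, (trivializationAt E (TangentSpace 𝓘(ℝ, E) : M → Type _) x).symm z u =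
        mfderiv 𝓘(ℝ, E) 𝓘(ℝ, E) (extChartAt 𝓘(ℝ, E) x).symm (extChartAt 𝓘(ℝ, E) x z) u := by
      intro u
      have h3 := TangentBundle.symmL_trivializationAt (𝕜 := ℝ) (I := 𝓘(ℝ, E)) hz
      rw [modelWithCornersSelf_coe, range_id, mfderivWithin_univ] at h3
      exact (Bundle.Trivialization.symmL_apply _ hb _).symm.trans (DFunLike.congr_fun h3 u)
    rw [hsymm, hsymm, inducedForm_apply,
      fderiv_chartRep hf ((extChartAt 𝓘(ℝ, E) x).map_source hz')]
    have e : modelDeriv E f ((extChartAt 𝓘(ℝ, E) x).symm (extChartAt 𝓘(ℝ, E) x z)) =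
        modelDeriv E f z := by
      rw [(extChartAt 𝓘(ℝ, E) x).left_inv hz']
    rw [e]
    refine (DFunLike.congr_fun (Trivial.linearMapAt_trivialization ℝ M ℝ z) _).trans ?_
    rfl

/-- The chain rule; it reduces every coordinate statement about the metric to an immersion of an
open set of `E` into `V`. -/
theorem SmoothMetric.inChart_ofImmersion [FiniteDimensional ℝ E] {f : M → V}
    (hf : ContMDiff 𝓘(ℝ, E) 𝓘(ℝ, V) ∞ f)
    (himm : ∀ x, Function.Injective (modelDeriv E f x)) {x : M} {y : E}
    (hy : y ∈ (extChartAt 𝓘(ℝ, E) x).target) :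
    (SmoothMetric.ofImmersion f hf himm).inChart x y = inducedForm (fderiv ℝ (chartRep E f x) y) := by
  rw [fderiv_chartRep hf hy]
  rfl

theorem fderiv_chartRep_injective {f : M → V} (hf : ContMDiff 𝓘(ℝ, E) 𝓘(ℝ, V) ∞ f)
    (himm : ∀ x, Function.Injective (modelDeriv E f x)) {x : M} {y : E}
    (hy : y ∈ (extChartAt 𝓘(ℝ, E) x).target) :
    Function.Injective (fderiv ℝ (chartRep E f x) y) := by
  rw [fderiv_chartRep hf hy]
  refine (himm _).comp ?_
  have h : Function.Injective (mfderiv[range 𝓘(ℝ, E)] (extChartAt 𝓘(ℝ, E) x).symm y) :=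
    (isInvertible_mfderivWithin_extChartAt_symm hy).injective
  rw [modelWithCornersSelf_coe, range_id, mfderivWithin_univ] at h
  exact h

/-- A self-map of `M` that is intertwined by `f` with a linear isometry of `V` preserves the
metric induced by `f`. -/
theorem SmoothMetric.isPreservedBy_ofImmersion [FiniteDimensional ℝ E] {f : M → V}
    (hf : ContMDiff 𝓘(ℝ, E) 𝓘(ℝ, V) ∞ f)
    (himm : ∀ x, Function.Injective (modelDeriv E f x)) {Φ : M → M}
    (hΦ : MDifferentiable 𝓘(ℝ, E) 𝓘(ℝ, E) Φ) (L : V →ₗᵢ[ℝ] V) (h : ∀ x, f (Φ x) = L (f x)) :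
    (SmoothMetric.ofImmersion f hf himm).IsPreservedBy Φ := by
  intro x v w
  have hfd := hf.mdifferentiable (by simp)
  have h1 := mfderiv_comp x (hfd (Φ x)) (hΦ x)
  have h2 := mfderiv_comp x (L.toContinuousLinearMap.mdifferentiableAt (x := f x)) (hfd x)
  rw [show f ∘ Φ = L.toContinuousLinearMap ∘ f from funext h, h2] at h1
  have h3 : ∀ u : TangentSpace 𝓘(ℝ, E) x, modelDeriv E f (Φ x)
      (mfderiv 𝓘(ℝ, E) 𝓘(ℝ, E) Φ x u) = L (modelDeriv E f x u) := by
    intro u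
    have h4 := DFunLike.congr_fun h1 u
    rw [ContinuousLinearMap.mfderiv_eq] at h4
    exact h4.symm
  change inner ℝ (modelDeriv E f (Φ x) (mfderiv 𝓘(ℝ, E) 𝓘(ℝ, E) Φ x v))
    (modelDeriv E f (Φ x) (mfderiv 𝓘(ℝ, E) 𝓘(ℝ, E) Φ x w)) =
    inner ℝ (modelDeriv E f x v) (modelDeriv E f x w)
  rw [h3, h3, L.inner_map_map]

end Immersion

/-! ## Quadratic cones -/

section Cone

variable {P Q : Type*} [NormedAddCommGroup P] [InnerProductSpace ℝ P]
  [NormedAddCommGroup Q] [InnerProductSpace ℝ Q]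

/-- The linear map `(x, y) ↦ (a x, b y)` of an orthogonal sum. -/
def scaleSum (a b : ℝ) : WithLp 2 (P × Q) →L[ℝ] WithLp 2 (P × Q) :=
  (WithLp.prodContinuousLinearEquiv 2 ℝ P Q).symm.toContinuousLinearMap ∘L
    ((a • WithLp.fstL 2 ℝ P Q).prod (b • WithLp.sndL 2 ℝ P Q))

@[simp] theorem scaleSum_fst (a b : ℝ) (X : WithLp 2 (P × Q)) : (scaleSum a b X).fst = a • X.fst :=
  rfl

@[simp] theorem scaleSum_snd (a b : ℝ) (X : WithLp 2 (P × Q)) : (scaleSum a b X).snd = b • X.snd :=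
  rfl

/-- The height `√(t |x|² + |y|²)` of a quadratic cone. -/
def coneHeight (t : ℝ) (X : WithLp 2 (P × Q)) : ℝ := √(t * ‖X.fst‖ ^ 2 + ‖X.snd‖ ^ 2)

/-- The map `(x, y) ↦ (x, √t y, √(t |x|² + |y|²)) / √(1 + t)`, which sends the unit sphere into the
intersection of the unit sphere with the quadratic cone `z² = t |x|² + |y|² / t`. -/
def coneMap (t : ℝ) (X : WithLp 2 (P × Q)) : WithLp 2 (WithLp 2 (P × Q) × ℝ) :=
  (√(1 + t))⁻¹ • WithLp.toLp 2 (scaleSum 1 (√t) X, coneHeight t X)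

/-- The derivative of `coneHeight`. -/
def coneHeightDeriv (t : ℝ) (X : WithLp 2 (P × Q)) : WithLp 2 (P × Q) →L[ℝ] ℝ :=
  (coneHeight t X)⁻¹ • (t • (innerSL ℝ X.fst ∘L WithLp.fstL 2 ℝ P Q)
    + innerSL ℝ X.snd ∘L WithLp.sndL 2 ℝ P Q)

theorem coneHeightDeriv_apply (t : ℝ) (X v : WithLp 2 (P × Q)) : coneHeightDeriv t X v =
    (coneHeight t X)⁻¹ * (t * inner ℝ X.fst v.fst + inner ℝ X.snd v.snd) := rfl

/-- The derivative of `coneMap`. -/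
def coneMapDeriv (t : ℝ) (X : WithLp 2 (P × Q)) :
    WithLp 2 (P × Q) →L[ℝ] WithLp 2 (WithLp 2 (P × Q) × ℝ) :=
  (√(1 + t))⁻¹ • ((WithLp.prodContinuousLinearEquiv 2 ℝ (WithLp 2 (P × Q)) ℝ).symm :
    WithLp 2 (P × Q) × ℝ →L[ℝ] WithLp 2 (WithLp 2 (P × Q) × ℝ)) ∘L
      ((scaleSum 1 (√t)).prod (coneHeightDeriv t X))

theorem coneMapDeriv_apply (t : ℝ) (X v : WithLp 2 (P × Q)) : coneMapDeriv t X v =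
    (√(1 + t))⁻¹ • WithLp.toLp 2 (scaleSum 1 (√t) v, coneHeightDeriv t X v) := rfl

variable {t : ℝ} {X : WithLp 2 (P × Q)}

omit [InnerProductSpace ℝ P] [InnerProductSpace ℝ Q] in
theorem coneHeight_sq (ht : 0 ≤ t) (X : WithLp 2 (P × Q)) :
    coneHeight t X ^ 2 = t * ‖X.fst‖ ^ 2 + ‖X.snd‖ ^ 2 :=
  Real.sq_sqrt (by positivity)

omit [InnerProductSpace ℝ P] [InnerProductSpace ℝ Q] in
theorem cone_pos (ht : 0 < t) (hX : X ≠ 0) : 0 < t * ‖X.fst‖ ^ 2 + ‖X.snd‖ ^ 2 := by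
  have h : 0 < ‖X‖ ^ 2 := by positivity
  rw [WithLp.prod_norm_sq_eq_of_L2] at h
  rcases (sq_nonneg ‖X.fst‖).eq_or_lt with h1 | h1
  · rw [← h1] at h ⊢; linarith
  · have := mul_pos ht h1
    positivity

omit [InnerProductSpace ℝ P] [InnerProductSpace ℝ Q] in
theorem coneHeight_pos (ht : 0 < t) (hX : X ≠ 0) : 0 < coneHeight t X :=
  Real.sqrt_pos.2 (cone_pos ht hX)

theorem hasFDerivAt_coneHeight (ht : 0 < t) (hX : X ≠ 0) :
    HasFDerivAt (coneHeight t : WithLp 2 (P × Q) → ℝ) (coneHeightDeriv t X) X := by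
  have h1 := ((WithLp.fstL 2 ℝ P Q).hasFDerivAt (x := X)).norm_sq.const_mul t
  have h2 := ((WithLp.sndL 2 ℝ P Q).hasFDerivAt (x := X)).norm_sq
  have h3 := (h1.add h2).sqrt (cone_pos ht hX).ne'
  refine h3.congr_fderiv ?_
  ext v
  have e : √(t * ‖X.fst‖ ^ 2 + ‖X.snd‖ ^ 2) = coneHeight t X := rfl
  simp only [coneHeightDeriv_apply, smul_apply, add_apply,
    ContinuousLinearMap.comp_apply, innerSL_apply_apply, WithLp.fstL_apply, WithLp.sndL_apply,
    smul_eq_mul, nsmul_eq_mul, Pi.add_apply, e]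
  have := (coneHeight_pos ht hX).ne'
  field_simp
  push_cast
  ring

theorem hasFDerivAt_coneMap (ht : 0 < t) (hX : X ≠ 0) :
    HasFDerivAt (coneMap t : WithLp 2 (P × Q) → _) (coneMapDeriv t X) X :=
  (((WithLp.prodContinuousLinearEquiv 2 ℝ (WithLp 2 (P × Q)) ℝ).symm.hasFDerivAt).comp X
    ((scaleSum 1 (√t)).hasFDerivAt.prodMk (hasFDerivAt_coneHeight ht hX))).const_smul (√(1 + t))⁻¹

/-- Smoothness is needed jointly in parameter and point for the continuity of the family; both
square roots stay away from `0` here. -/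
theorem contDiffAt_coneMap (ht : 0 < t) (hX : X ≠ 0) :
    ContDiffAt ℝ ∞ (fun z : ℝ × WithLp 2 (P × Q) ↦ coneMap z.1 z.2) (t, X) := by
  have hfst : ContDiffAt ℝ ∞ (fun z : ℝ × WithLp 2 (P × Q) ↦ z.2.fst) (t, X) :=
    (WithLp.fstL 2 ℝ P Q).contDiff.contDiffAt.comp _ contDiffAt_snd
  have hsnd : ContDiffAt ℝ ∞ (fun z : ℝ × WithLp 2 (P × Q) ↦ z.2.snd) (t, X) :=
    (WithLp.sndL 2 ℝ P Q).contDiff.contDiffAt.comp _ contDiffAt_snd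
  have hs : ContDiffAt ℝ ∞ (fun z : ℝ × WithLp 2 (P × Q) ↦ √z.1) (t, X) :=
    contDiffAt_fst.sqrt ht.ne'
  have hr : ContDiffAt ℝ ∞ (fun z : ℝ × WithLp 2 (P × Q) ↦ coneHeight z.1 z.2) (t, X) :=
    ((contDiffAt_fst.mul (hfst.norm_sq ℝ)).add (hsnd.norm_sq ℝ)).sqrt (cone_pos ht hX).ne'
  have hc : ContDiffAt ℝ ∞ (fun z : ℝ × WithLp 2 (P × Q) ↦ (√(1 + z.1))⁻¹) (t, X) :=
    ((contDiffAt_const.add contDiffAt_fst).sqrt (by positivity)).inv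
      (Real.sqrt_pos.2 (by positivity)).ne'
  have h1 : ContDiffAt ℝ ∞ (fun z : ℝ × WithLp 2 (P × Q) ↦
      (WithLp.toLp 2 ((1 : ℝ) • z.2.fst, √z.1 • z.2.snd) : WithLp 2 (P × Q))) (t, X) :=
    WithLp.contDiff_toLp.contDiffAt.comp _
      (ContDiffAt.prodMk (contDiffAt_const.smul hfst) (hs.smul hsnd))
  exact hc.smul (WithLp.contDiff_toLp.contDiffAt.comp _ (h1.prodMk hr))

/-- The squares add up to `(1 + t)(|x|² + |y|²)` before normalisation, which is where the factor
`1/√(1 + t)` comes from. -/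
theorem norm_coneMap (ht : 0 ≤ t) (X : WithLp 2 (P × Q)) : ‖coneMap t X‖ = ‖X‖ := by
  have h : ‖coneMap t X‖ ^ 2 = ‖X‖ ^ 2 := by
    rw [coneMap, norm_smul, mul_pow, WithLp.prod_norm_sq_eq_of_L2, WithLp.toLp_fst,
      WithLp.toLp_snd, WithLp.prod_norm_sq_eq_of_L2, Real.norm_eq_abs (coneHeight t X), sq_abs,
      coneHeight_sq ht, scaleSum_fst, scaleSum_snd, norm_smul, norm_smul, mul_pow, mul_pow,
      norm_inv, inv_pow, Real.norm_eq_abs, Real.norm_eq_abs √t, sq_abs, sq_abs,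
      Real.sq_sqrt (by positivity), Real.sq_sqrt ht, WithLp.prod_norm_sq_eq_of_L2 X]
    simp only [norm_one]
    field_simp
    ring
  exact (pow_left_inj₀ (norm_nonneg _) (norm_nonneg _) two_ne_zero).1 h

theorem coneMapDeriv_injective (ht : 0 < t) (X : WithLp 2 (P × Q)) :
    Function.Injective (coneMapDeriv t X) := by
  rw [injective_iff_map_eq_zero]
  intro v hv
  have hc : (√(1 + t))⁻¹ ≠ 0 := (inv_pos.2 (Real.sqrt_pos.2 (by positivity))).ne'
  rw [coneMapDeriv_apply, smul_eq_zero_iff_right hc] at hv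
  have h1 : scaleSum 1 (√t) v = 0 := congrArg WithLp.fst hv
  have h2 : (1 : ℝ) • v.fst = 0 := congrArg WithLp.fst h1
  have h3 : √t • v.snd = 0 := congrArg WithLp.snd h1
  rw [one_smul] at h2
  rw [smul_eq_zero_iff_right (Real.sqrt_pos.2 ht).ne'] at h3
  exact WithLp.ofLp_injective 2 (Prod.ext h2 h3)

/-- Half the gradient of the quadratic form `t |x|² + |y|² / t - z²`. -/
def coneForm (t : ℝ) :
    WithLp 2 (WithLp 2 (P × Q) × ℝ) →L[ℝ] WithLp 2 (WithLp 2 (P × Q) × ℝ) :=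
  ((WithLp.prodContinuousLinearEquiv 2 ℝ (WithLp 2 (P × Q)) ℝ).symm :
    WithLp 2 (P × Q) × ℝ →L[ℝ] WithLp 2 (WithLp 2 (P × Q) × ℝ)) ∘L
    ((scaleSum t t⁻¹ ∘L WithLp.fstL 2 ℝ (WithLp 2 (P × Q)) ℝ).prod
      (-WithLp.sndL 2 ℝ (WithLp 2 (P × Q)) ℝ))

theorem inner_coneForm (t : ℝ) (u v : WithLp 2 (WithLp 2 (P × Q) × ℝ)) :
    inner ℝ (coneForm t u) v = t * inner ℝ u.fst.fst v.fst.fst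
      + t⁻¹ * inner ℝ u.fst.snd v.fst.snd - u.snd * v.snd := by
  rw [WithLp.prod_inner_apply, WithLp.prod_inner_apply]
  change inner ℝ (t • u.fst.fst) v.fst.fst + inner ℝ (t⁻¹ • u.fst.snd) v.fst.snd
    + inner ℝ (-u.snd) v.snd = _
  simp only [inner_smul_left, inner_neg_left]
  simp
  ring

theorem coneForm_symm (t : ℝ) (u v : WithLp 2 (WithLp 2 (P × Q) × ℝ)) :
    inner ℝ (coneForm t u) v = inner ℝ u (coneForm t v) := by
  rw [inner_coneForm, ← real_inner_comm u, inner_coneForm, real_inner_comm u.fst.fst,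
    real_inner_comm u.fst.snd]
  ring

theorem inner_coneForm_coneMap (ht : 0 < t) (X : WithLp 2 (P × Q)) :
    inner ℝ (coneForm t (coneMap t X)) (coneMap t X) = 0 := by
  rw [coneMap, map_smul, inner_smul_left, inner_smul_right, inner_coneForm]
  simp only [WithLp.toLp_fst, WithLp.toLp_snd, scaleSum_fst, scaleSum_snd, one_smul, inner_smul_left, inner_smul_right,
    conj_trivial, real_inner_self_eq_norm_sq]
  have h := coneHeight_sq ht.le X
  have h2 := Real.mul_self_sqrt ht.le
  have h3 : t * ‖X.fst‖ ^ 2 + t⁻¹ * (√t * (√t * ‖X.snd‖ ^ 2)) - coneHeight t X * coneHeight t X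
      = 0 := by
    rw [← mul_assoc √t, h2, ← mul_assoc, inv_mul_cancel₀ ht.ne', ← pow_two, h]
    ring
  rw [h3, mul_zero, mul_zero]

theorem coneForm_coneMap_ne_zero (ht : 0 < t) (hX : X ≠ 0) : coneForm t (coneMap t X) ≠ 0 := by
  intro h
  have h1 : -((√(1 + t))⁻¹ * coneHeight t X) = 0 := congrArg WithLp.snd h
  have h2 : 0 < (√(1 + t))⁻¹ * coneHeight t X :=
    mul_pos (inv_pos.2 (Real.sqrt_pos.2 (by positivity))) (coneHeight_pos ht hX)
  linarith

/-- On the tangent spaces of the cone the quadratic form `t |x|² + |y|² / t - z²` is a sum of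
squares. -/
theorem inner_coneForm_coneMapDeriv (ht : 0 < t) (hX : X ≠ 0) (v w : WithLp 2 (P × Q)) :
    inner ℝ (coneForm t (coneMapDeriv t X v)) (coneMapDeriv t X w) =
      inner ℝ
        ((√(1 + t))⁻¹ • (scaleSum (√t) 1 v
          - (coneHeightDeriv t X v / coneHeight t X) • scaleSum (√t) 1 X))
        ((√(1 + t))⁻¹ • (scaleSum (√t) 1 w
          - (coneHeightDeriv t X w / coneHeight t X) • scaleSum (√t) 1 X)) := by
  have hr := (coneHeight_pos ht hX).ne'
  have hst := Real.mul_self_sqrt ht.le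
  -- Write `B` for the form `t|x|² + |y|²` and `r` for the height. Then `r² = B(X, X)` and `r dr(v)
  -- = B(X, v)`, so the vectors on the right are the `B`-projections orthogonal to `X`, and `B(v, w)
  -- - dr(v) dr(w)` is their `B`-product.
  have hin : ∀ u u' : WithLp 2 (P × Q), inner ℝ (scaleSum (√t) 1 u) (scaleSum (√t) 1 u') =
      t * inner ℝ u.fst u'.fst + inner ℝ u.snd u'.snd := by
    intro u u'
    rw [WithLp.prod_inner_apply]
    change inner ℝ (√t • u.fst) (√t • u'.fst) + inner ℝ ((1 : ℝ) • u.snd) ((1 : ℝ) • u'.snd) = _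
    simp only [inner_smul_left, inner_smul_right, one_smul]
    simp only [conj_trivial]
    rw [← mul_assoc, hst]
  have hX2 : inner ℝ (scaleSum (√t) 1 X) (scaleSum (√t) 1 X) = coneHeight t X ^ 2 := by
    rw [hin, real_inner_self_eq_norm_sq, real_inner_self_eq_norm_sq, coneHeight_sq ht.le]
  have hXu : ∀ u, inner ℝ (scaleSum (√t) 1 X) (scaleSum (√t) 1 u) =
      coneHeight t X * coneHeightDeriv t X u := by
    intro u
    rw [hin, coneHeightDeriv_apply, mul_inv_cancel_left₀ hr]
  have huX : ∀ u, inner ℝ (scaleSum (√t) 1 u) (scaleSum (√t) 1 X) =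
      coneHeight t X * coneHeightDeriv t X u := fun u ↦ by rw [real_inner_comm, hXu]
  rw [coneMapDeriv_apply, coneMapDeriv_apply, map_smul, inner_smul_left, inner_smul_right,
    inner_smul_left, inner_smul_right, inner_coneForm]
  congr 2
  simp only [inner_sub_left, inner_sub_right, inner_smul_left, inner_smul_right, hX2, hXu, huX]
  rw [hin]
  simp only [WithLp.toLp_fst, WithLp.toLp_snd, scaleSum_fst, scaleSum_snd, one_smul, inner_smul_left, inner_smul_right,
    conj_trivial]
  rw [← mul_assoc √t, hst, ← mul_assoc t⁻¹, inv_mul_cancel₀ ht.ne']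
  field_simp
  ring

end Cone

/-! ## Parametric smoothness of iterated derivatives -/

section Parametric

universe u

variable {E F : Type u} [NormedAddCommGroup E] [NormedSpace ℝ E]
  [NormedAddCommGroup F] [NormedSpace ℝ F]

theorem contDiffAt_parametric_fderiv {f : ℝ → E → F} {z : ℝ × E}
    (hf : ContDiffAt ℝ ∞ (fun z : ℝ × E ↦ f z.1 z.2) z) :
    ContDiffAt ℝ ∞ (fun z : ℝ × E ↦ fderiv ℝ (f z.1) z.2) z := by
  refine ContDiffAt.fderiv (f := fun (z : ℝ × E) (y : E) ↦ f z.1 y) (g := Prod.snd) (n := ∞)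
    ?_ contDiffAt_snd (by simp)
  exact ContDiffAt.comp (f := fun w : (ℝ × E) × E ↦ (w.1.1, w.2)) (z, z.2) hf
    ((contDiffAt_fst.comp _ contDiffAt_fst).prodMk contDiffAt_snd)

/-- One derivative at a time, replacing `F` by `E →L[ℝ] F`; the common universe of `E` and `F` lets
the induction stay in one universe. -/
theorem continuousAt_parametric_iteratedFDeriv (k : ℕ) {f : ℝ → E → F} {z : ℝ × E}
    (hf : ContDiffAt ℝ ∞ (fun z : ℝ × E ↦ f z.1 z.2) z) :
    ContinuousAt (fun z : ℝ × E ↦ iteratedFDeriv ℝ k (f z.1) z.2) z := by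
  induction k generalizing F with
  | zero =>
    exact (continuousMultilinearCurryFin0 ℝ E F).symm.continuous.continuousAt.comp hf.continuousAt
  | succ k ih =>
    have h := (continuousMultilinearCurryRightEquiv' ℝ k E F).symm.continuous.continuousAt.comp
      (ih (f := fun t ↦ fderiv ℝ (f t)) (contDiffAt_parametric_fderiv hf))
    have e : (fun z : ℝ × E ↦ iteratedFDeriv ℝ (k + 1) (f z.1) z.2) =
        (continuousMultilinearCurryRightEquiv' ℝ k E F).symm ∘
          fun z : ℝ × E ↦ iteratedFDeriv ℝ k (fderiv ℝ (f z.1)) z.2 :=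
      funext fun z ↦ by rw [iteratedFDeriv_succ_eq_comp_right]; rfl
    rw [e]
    exact h

end Parametric

/-! ## The family of metrics on the sphere -/

section Family

variable {p q : ℕ}

theorem SplitSphere.ne_zero (x : SplitSphere p q) : (x : SplitSpace p q) ≠ 0 :=
  norm_ne_zero_iff.1 (by rw [norm_eq_of_mem_sphere]; exact one_ne_zero)

variable [Fact (2 ≤ p)]

/-- The charts are stereographic projections, onto the whole model space. Chart representatives are
therefore immersions of all of `E`, as the Gauss equation above assumes. -/
theorem SplitSphere.target_extChartAt (x : SplitSphere p q) :
    (extChartAt 𝓘(ℝ, EuclideanSpace ℝ (Fin (p + q - 1))) x).target = univ := by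
  have h : chartAt (EuclideanSpace ℝ (Fin (p + q - 1))) x = stereographic' (p + q - 1) (-x) := rfl
  simp [h]

/-- The restriction of `coneMap` to the unit sphere. -/
def coneImmersion (t : ℝ) (x : SplitSphere p q) : WithLp 2 (SplitSpace p q × ℝ) := coneMap t x

theorem contMDiff_coneImmersion {t : ℝ} (ht : 0 < t) :
    ContMDiff 𝓘(ℝ, EuclideanSpace ℝ (Fin (p + q - 1))) 𝓘(ℝ, WithLp 2 (SplitSpace p q × ℝ)) ∞
      (coneImmersion (p := p) (q := q) t) := by
  intro x
  have h : ContDiffAt ℝ ∞ (coneMap t : SplitSpace p q → _) x :=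
    (contDiffAt_coneMap ht x.ne_zero).comp (x : SplitSpace p q)
      (contDiffAt_const.prodMk contDiffAt_id)
  exact h.contMDiffAt.comp x (contMDiff_coe_sphere x)

/-- The derivative of the inclusion of the sphere. -/
abbrev sphereDeriv (x : SplitSphere p q) :
    EuclideanSpace ℝ (Fin (p + q - 1)) →L[ℝ] SplitSpace p q :=
  modelDeriv _ (Subtype.val : SplitSphere p q → SplitSpace p q) x

theorem modelDeriv_coneImmersion {t : ℝ} (ht : 0 < t) (x : SplitSphere p q) :
    modelDeriv (EuclideanSpace ℝ (Fin (p + q - 1))) (coneImmersion t) x =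
      (coneMapDeriv t (x : SplitSpace p q)).comp (sphereDeriv x) := by
  have h1 := (hasFDerivAt_coneMap ht x.ne_zero).hasMFDerivAt
  have h2 := (contMDiff_coe_sphere (m := ∞) (n := p + q - 1) (E := SplitSpace p q)
    x).mdifferentiableAt (by simp)
  exact (h1.comp x h2.hasMFDerivAt).mfderiv

theorem sphereDeriv_injective (x : SplitSphere p q) : Function.Injective (sphereDeriv x) :=
  injective_mvfderiv_subtypeVal_sphere x

theorem modelDeriv_coneImmersion_injective {t : ℝ} (ht : 0 < t) (x : SplitSphere p q) :
    Function.Injective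
      (modelDeriv (EuclideanSpace ℝ (Fin (p + q - 1))) (coneImmersion t) x) := by
  rw [modelDeriv_coneImmersion ht]
  exact (coneMapDeriv_injective ht _).comp (sphereDeriv_injective x)

/-- The metric on the sphere induced by `coneImmersion t`. -/
def coneMetric (p q : ℕ) [Fact (2 ≤ p)] {t : ℝ} (ht : 0 < t) :
    SmoothMetric (EuclideanSpace ℝ (Fin (p + q - 1))) (SplitSphere p q) :=
  SmoothMetric.ofImmersion (coneImmersion t) (contMDiff_coneImmersion ht)
    (modelDeriv_coneImmersion_injective ht)

/-- The family of metrics on the sphere induced by `coneImmersion`, for positive parameters. -/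
def coneFamily (p q : ℕ) [Fact (2 ≤ p)] (t : ℝ) :
    SmoothMetric (EuclideanSpace ℝ (Fin (p + q - 1))) (SplitSphere p q) :=
  -- The value for `t ≤ 0` is arbitrary: only `t` in `(0, 1]` and the limit from the right matter.
  if ht : 0 < t then coneMetric p q ht else coneMetric p q one_pos

theorem coneFamily_of_pos {t : ℝ} (ht : 0 < t) : coneFamily p q t = coneMetric p q ht :=
  dif_pos ht

theorem inChart_coneMetric {t : ℝ} (ht : 0 < t) (x : SplitSphere p q) :
    (coneMetric p q ht).inChart x = fun y ↦ inducedForm (fderiv ℝ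
      (chartRep (EuclideanSpace ℝ (Fin (p + q - 1))) (coneImmersion t) x) y) :=
  funext fun _ ↦ SmoothMetric.inChart_ofImmersion _ _
    (by rw [SplitSphere.target_extChartAt]; trivial)

/-- `coneMap t` intertwines `(A, B)` with the isometry `(A, B, 1)`, because the height depends only
on `|x|` and `|y|`. -/
theorem isPreservedBy_coneMetric {t : ℝ} (ht : 0 < t)
    (A : EuclideanSpace ℝ (Fin p) ≃ₗᵢ[ℝ] EuclideanSpace ℝ (Fin p))
    (B : EuclideanSpace ℝ (Fin q) ≃ₗᵢ[ℝ] EuclideanSpace ℝ (Fin q)) :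
    (coneMetric p q ht).IsPreservedBy (splitAction A B) := by
  have hsm : ContMDiff 𝓘(ℝ, EuclideanSpace ℝ (Fin (p + q - 1)))
      𝓘(ℝ, EuclideanSpace ℝ (Fin (p + q - 1))) ∞ (splitAction A B) := by
    have h1 : ContMDiff 𝓘(ℝ, EuclideanSpace ℝ (Fin (p + q - 1))) 𝓘(ℝ, SplitSpace p q) ∞
        fun x : SplitSphere p q ↦ LinearIsometryEquiv.withLpProdCongr 2 A B (x : SplitSpace p q) :=
      (LinearIsometryEquiv.contDiff _).contMDiff.comp contMDiff_coe_sphere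
    exact h1.codRestrict_sphere fun x ↦ (splitAction A B x).2
  refine SmoothMetric.isPreservedBy_ofImmersion _ _ (hsm.mdifferentiable (by simp))
    (LinearIsometryEquiv.withLpProdCongr 2 (LinearIsometryEquiv.withLpProdCongr 2 A B)
      (LinearIsometryEquiv.refl ℝ ℝ)).toLinearIsometry fun x ↦ ?_
  have hr : coneHeight t (splitAction A B x : SplitSpace p q) =
      coneHeight t (x : SplitSpace p q) := by
    change √(t * ‖A (x : SplitSpace p q).fst‖ ^ 2 + ‖B (x : SplitSpace p q).snd‖ ^ 2) = _
    rw [A.norm_map, B.norm_map]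
    rfl
  have hs : scaleSum 1 (√t) (splitAction A B x : SplitSpace p q) =
      LinearIsometryEquiv.withLpProdCongr 2 A B (scaleSum 1 (√t) (x : SplitSpace p q)) := by
    refine WithLp.ofLp_injective 2 (Prod.ext ?_ ?_)
    · exact (map_smul A (1 : ℝ) (x : SplitSpace p q).fst).symm
    · exact (map_smul B (√t) (x : SplitSpace p q).snd).symm
  rw [coneImmersion, coneImmersion, coneMap, hr, hs, coneMap, LinearIsometry.map_smul]
  rfl

theorem curvatureOperatorGE_coneMetric {t : ℝ} (ht : 0 < t) :
    (coneMetric p q ht).CurvatureOperatorGE 1 := by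
  intro x
  rw [inChart_coneMetric]
  set y₀ := extChartAt 𝓘(ℝ, EuclideanSpace ℝ (Fin (p + q - 1))) x x
  have hmem : ∀ y, y ∈ (extChartAt 𝓘(ℝ, EuclideanSpace ℝ (Fin (p + q - 1))) x).target := fun y ↦ by
    rw [SplitSphere.target_extChartAt]; trivial
  have hdim : Module.finrank ℝ (WithLp 2 (SplitSpace p q × ℝ)) =
      Module.finrank ℝ (EuclideanSpace ℝ (Fin (p + q - 1))) + 2 := by
    have hp : 2 ≤ p := Fact.out
    rw [LinearEquiv.finrank_eq (WithLp.linearEquiv 2 ℝ (SplitSpace p q × ℝ)),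
      Module.finrank_prod, finrank_splitSpace, finrank_euclideanSpace_fin, Module.finrank_self]
    omega
  let T : EuclideanSpace ℝ (Fin (p + q - 1)) →L[ℝ] SplitSpace p q :=
    fderiv ℝ (chartRep _ (Subtype.val : SplitSphere p q → SplitSpace p q) x) y₀
  have hcoe : ContMDiff 𝓘(ℝ, EuclideanSpace ℝ (Fin (p + q - 1))) 𝓘(ℝ, SplitSpace p q) ∞
      (Subtype.val : SplitSphere p q → SplitSpace p q) := contMDiff_coe_sphere
  let z := (extChartAt 𝓘(ℝ, EuclideanSpace ℝ (Fin (p + q - 1))) x).symm y₀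
  have hT : ∀ v, fderiv ℝ (chartRep _ (coneImmersion t) x) y₀ v =
      coneMapDeriv t (z : SplitSpace p q) (T v) := by
    intro v
    rw [fderiv_chartRep (contMDiff_coneImmersion ht) (hmem y₀), modelDeriv_coneImmersion ht]
    exact congrArg (coneMapDeriv t (z : SplitSpace p q))
      (DFunLike.congr_fun (fderiv_chartRep hcoe (hmem y₀)) v).symm
  refine curvatureOperatorGEAt_one_of_cone
    (contDiff_iff_contDiffAt.2 fun y ↦ contDiffAt_chartRep (contMDiff_coneImmersion ht) (hmem y))
    (fun y ↦ fderiv_chartRep_injective (contMDiff_coneImmersion ht)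
      (modelDeriv_coneImmersion_injective ht) (hmem y))
    (fun y ↦ ?_) hdim (coneForm t) (coneForm_symm t) (fun y ↦ inner_coneForm_coneMap ht _)
    (coneForm_coneMap_ne_zero ht (SplitSphere.ne_zero _))
    -- The witness `S` is the square root of the tangential form supplied by
    -- `inner_coneForm_coneMapDeriv`.
    (fun v ↦ (√(1 + t))⁻¹ • (scaleSum (√t) 1 (T v)
      - (coneHeightDeriv t (z : SplitSpace p q) (T v) / coneHeight t (z : SplitSpace p q)) •
        scaleSum (√t) 1 (z : SplitSpace p q))) fun v w ↦ ?_
  · rw [chartRep, coneImmersion, norm_coneMap ht.le, norm_eq_of_mem_sphere]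
  · rw [hT, hT, inner_coneForm_coneMapDeriv ht (SplitSphere.ne_zero _)]

theorem continuousFamilyOn_coneFamily :
    SmoothMetric.ContinuousFamilyOn (coneFamily p q) (Ioc 0 1) := by
  intro x k
  rw [SplitSphere.target_extChartAt]
  have h : ContinuousOn (fun z : ℝ × EuclideanSpace ℝ (Fin (p + q - 1)) ↦
      iteratedFDeriv ℝ k ((fun (t : ℝ) (y : EuclideanSpace ℝ (Fin (p + q - 1))) ↦
        inducedForm (fderiv ℝ (chartRep (EuclideanSpace ℝ (Fin (p + q - 1)))
          (coneImmersion t) x) y)) z.1) z.2) (Ioc 0 1 ×ˢ univ) := by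
    rintro z ⟨hz, -⟩
    have hcoe : ContMDiff 𝓘(ℝ, EuclideanSpace ℝ (Fin (p + q - 1))) 𝓘(ℝ, SplitSpace p q) ∞
      (Subtype.val : SplitSphere p q → SplitSpace p q) := contMDiff_coe_sphere
    have h1 : ContDiffAt ℝ ∞ (chartRep (EuclideanSpace ℝ (Fin (p + q - 1)))
        (Subtype.val : SplitSphere p q → SplitSpace p q) x) z.2 :=
      contDiffAt_chartRep hcoe (by rw [SplitSphere.target_extChartAt]; trivial)
    have h2 : ContDiffAt ℝ ∞ (fun z : ℝ × EuclideanSpace ℝ (Fin (p + q - 1)) ↦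
        (fun t ↦ chartRep (EuclideanSpace ℝ (Fin (p + q - 1))) (coneImmersion t) x) z.1 z.2) z :=
      ContDiffAt.comp (g := fun z : ℝ × SplitSpace p q ↦ coneMap z.1 z.2)
        (f := fun z : ℝ × EuclideanSpace ℝ (Fin (p + q - 1)) ↦ (z.1, chartRep _ Subtype.val x z.2))
        z (contDiffAt_coneMap hz.1 (SplitSphere.ne_zero
          ((extChartAt 𝓘(ℝ, EuclideanSpace ℝ (Fin (p + q - 1))) x).symm z.2)))
        (contDiffAt_fst.prodMk (h1.comp z contDiffAt_snd))
    exact (continuousAt_parametric_iteratedFDeriv k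
      (f := fun t y ↦ inducedForm (fderiv ℝ (chartRep (EuclideanSpace ℝ (Fin (p + q - 1)))
        (coneImmersion t) x) y))
      (contDiff_inducedForm.contDiffAt.comp z
        (contDiffAt_parametric_fderiv (f := fun t ↦ chartRep (EuclideanSpace ℝ (Fin (p + q - 1)))
          (coneImmersion t) x) h2))).continuousWithinAt
  refine h.congr fun z hz ↦ ?_
  rw [coneFamily_of_pos hz.1.1, inChart_coneMetric]

end Family

/-! ## The Riemannian distance of an induced metric -/

section Distance

variable {E : Type*} [NormedAddCommGroup E] [NormedSpace ℝ E] [FiniteDimensional ℝ E]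
  {M : Type*} [TopologicalSpace M] [ChartedSpace E M] [IsManifold 𝓘(ℝ, E) ∞ M]
  {V : Type*} [NormedAddCommGroup V] [InnerProductSpace ℝ V]
  {W : Type*} [NormedAddCommGroup W] [InnerProductSpace ℝ W]

/-- The length of a curve in a sphere is at least the angle between its endpoints. -/
theorem angle_le_lintegral_derivWithin {U : ℝ → W} (hU : ContDiffOn ℝ 1 U (Icc 0 1))
    (hnorm : ∀ s ∈ Icc (0 : ℝ) 1, ‖U s‖ = 1) :
    ENNReal.ofReal (InnerProductGeometry.angle (U 0) (U 1)) ≤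
      ∫⁻ s in Icc (0 : ℝ) 1, ‖derivWithin U (Icc 0 1) s‖ₑ := by
  have h0 : (0 : ℝ) ∈ Icc (0 : ℝ) 1 := by simp
  have h1 : (1 : ℝ) ∈ Icc (0 : ℝ) 1 := by simp
  have hbound : ∀ s ∈ Icc (0 : ℝ) 1, |inner ℝ (U 0) (U s)| ≤ 1 := fun s hs ↦ by
    simpa [hnorm 0 h0, hnorm s hs] using abs_real_inner_le_norm (U 0) (U s)
  -- `arccos` is not differentiable at `±1`, so the cosine is first shrunk by `k < 1`, and `k → 1`
  -- at the end.
  have key : ∀ k ∈ Ioo (0 : ℝ) 1,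
      ENNReal.ofReal (Real.arccos (k * inner ℝ (U 0) (U 1)) - Real.arccos (k * inner ℝ (U 0) (U 0)))
        ≤ ∫⁻ s in Icc (0 : ℝ) 1, ‖derivWithin U (Icc 0 1) s‖ₑ := by
    intro k hk
    have hlt : ∀ s ∈ Icc (0 : ℝ) 1, |k * inner ℝ (U 0) (U s)| < 1 := fun s hs ↦ by
      rw [abs_mul, abs_of_pos hk.1]
      nlinarith [hbound s hs, hk.1, hk.2, abs_nonneg (inner ℝ (U 0) (U s))]
    have hin : ContDiffOn ℝ 1 (fun s ↦ k * inner ℝ (U 0) (U s)) (Icc 0 1) :=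
      contDiffOn_const.mul (contDiffOn_const.inner ℝ hU)
    have hg : ContDiffOn ℝ 1 (Real.arccos ∘ fun s ↦ k * inner ℝ (U 0) (U s)) (Icc 0 1) := by
      intro s hs
      have h := abs_lt.1 (hlt s hs)
      exact (Real.contDiffAt_arccos h.1.ne' h.2.ne).comp_contDiffWithinAt s (hin s hs)
    refine (Real.ofReal_le_enorm _).trans
      ((enorm_sub_le_lintegral_derivWithin_Icc_of_contDiffOn_Icc hg zero_le_one).trans ?_)
    refine MeasureTheory.setLIntegral_mono' measurableSet_Icc fun s hs ↦ ?_
    rw [enorm_le_iff_norm_le]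
    have hud : UniqueDiffWithinAt ℝ (Icc (0 : ℝ) 1) s := uniqueDiffOn_Icc zero_lt_one s hs
    have hUd : HasDerivWithinAt U (derivWithin U (Icc 0 1) s) (Icc 0 1) s :=
      (hU.differentiableOn (by simp) s hs).hasDerivWithinAt
    set U' := derivWithin U (Icc 0 1) s
    have horth : inner ℝ (U s) U' = 0 := by
      have h2 := hUd.inner ℝ hUd
      have h3 : HasDerivWithinAt (fun s ↦ inner ℝ (U s) (U s)) 0 (Icc 0 1) s :=
        (hasDerivWithinAt_const s _ (1 : ℝ)).congr
          (fun r hr ↦ by rw [real_inner_self_eq_norm_sq, hnorm r hr, one_pow])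
          (by rw [real_inner_self_eq_norm_sq, hnorm s hs, one_pow])
      have h4 := hud.eq_deriv _ h2 h3
      rw [real_inner_comm (U s) U'] at h4
      linarith
    have h := abs_lt.1 (hlt s hs)
    have hder : HasDerivWithinAt (Real.arccos ∘ fun s ↦ k * inner ℝ (U 0) (U s))
        (-(1 / √(1 - (k * inner ℝ (U 0) (U s)) ^ 2)) * (k * inner ℝ (U 0) U')) (Icc 0 1) s := by
      have h5 : HasDerivWithinAt (fun s ↦ k * inner ℝ (U 0) (U s)) (k * inner ℝ (U 0) U')
          (Icc 0 1) s := by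
        have h6 := ((hasDerivWithinAt_const s (Icc (0 : ℝ) 1) (U 0)).inner ℝ hUd).const_mul k
        simpa using h6
      exact (Real.hasDerivAt_arccos h.1.ne' h.2.ne).comp_hasDerivWithinAt s h5
    rw [hder.derivWithin hud]
    set u := inner ℝ (U 0) (U s)
    have hpos : 0 < 1 - (k * u) ^ 2 := by nlinarith [h.1, h.2]
    have hsq : 0 < √(1 - (k * u) ^ 2) := Real.sqrt_pos.2 hpos
    -- Since `U'` is orthogonal to `U s`, Cauchy–Schwarz may be applied to the component of `U 0`
    -- orthogonal to `U s`.
    have hcs : (inner ℝ (U 0) U') ^ 2 ≤ (1 - u ^ 2) * ‖U'‖ ^ 2 := by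
      have h7 : inner ℝ (U 0) U' = inner ℝ (U 0 - u • U s) U' := by
        rw [inner_sub_left, inner_smul_left, horth, mul_zero, sub_zero]
      have h8 : ‖U 0 - u • U s‖ ^ 2 = 1 - u ^ 2 := by
        rw [norm_sub_sq_real, inner_smul_right, norm_smul, mul_pow, hnorm 0 h0, hnorm s hs,
          Real.norm_eq_abs, sq_abs]
        ring
      rw [h7, ← h8, ← mul_pow, ← sq_abs]
      exact pow_le_pow_left₀ (abs_nonneg _) (abs_real_inner_le_norm _ _) 2
    rw [norm_mul, norm_neg, norm_div, norm_one, Real.norm_eq_abs, abs_of_pos hsq, one_div,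
      inv_mul_le_iff₀ hsq, Real.norm_eq_abs]
    refine abs_le_of_sq_le_sq ?_ (by positivity)
    rw [mul_pow, mul_pow, Real.sq_sqrt hpos.le]
    have hk2 : k ^ 2 ≤ 1 := by nlinarith [hk.1, hk.2]
    nlinarith [sq_nonneg ‖U'‖, mul_le_mul_of_nonneg_left hcs (sq_nonneg k),
      mul_nonneg (sub_nonneg.2 hk2) (sq_nonneg ‖U'‖)]
  have hlim : Tendsto (fun k : ℝ ↦ ENNReal.ofReal (Real.arccos (k * inner ℝ (U 0) (U 1))
      - Real.arccos (k * inner ℝ (U 0) (U 0)))) (𝓝[<] 1)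
      (𝓝 (ENNReal.ofReal (InnerProductGeometry.angle (U 0) (U 1)))) := by
    have hc : Continuous fun k : ℝ ↦ ENNReal.ofReal (Real.arccos (k * inner ℝ (U 0) (U 1))
      - Real.arccos (k * inner ℝ (U 0) (U 0))) :=
      ENNReal.continuous_ofReal.comp
        ((Real.continuous_arccos.comp (continuous_id.mul continuous_const)).sub
          (Real.continuous_arccos.comp (continuous_id.mul continuous_const)))
    have h2 := (hc.tendsto 1).mono_left (nhdsWithin_le_nhds (s := Iio 1))
    simpa [InnerProductGeometry.angle, hnorm 0 h0, hnorm 1 h1, real_inner_self_eq_norm_sq] using h2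
  refine le_of_tendsto hlim ?_
  filter_upwards [Ioo_mem_nhdsLT (zero_lt_one (α := ℝ))] with k hk using key k hk

variable {f : M → V} (hf : ContMDiff 𝓘(ℝ, E) 𝓘(ℝ, V) ∞ f)
  (himm : ∀ x, Function.Injective (modelDeriv E f x))

theorem SmoothMetric.enorm_ofImmersion (x : M) (v : TangentSpace 𝓘(ℝ, E) x) :
    letI : Bundle.RiemannianBundle (fun x : M ↦ TangentSpace 𝓘(ℝ, E) x) :=
      ⟨(SmoothMetric.ofImmersion f hf himm).toContinuousRiemannianMetric.toRiemannianMetric⟩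
    ‖v‖ₑ = ‖modelDeriv E f x v‖ₑ := by
  let : Bundle.RiemannianBundle (fun x : M ↦ TangentSpace 𝓘(ℝ, E) x) :=
    ⟨(SmoothMetric.ofImmersion f hf himm).toContinuousRiemannianMetric.toRiemannianMetric⟩
  rw [← ofReal_norm, ← ofReal_norm, norm_eq_sqrt_real_inner,
    norm_eq_sqrt_real_inner]
  rfl

variable [T3Space M]

theorem SmoothMetric.edist_ofImmersion_le {γ : ℝ → M} (hγ : ContMDiff 𝓘(ℝ, ℝ) 𝓘(ℝ, E) 1 γ)
    {C b : ℝ} (hb : 0 ≤ b) (hC : ∀ s, ‖deriv (f ∘ γ) s‖ ≤ C) :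
    (SmoothMetric.ofImmersion f hf himm).emetricSpace.edist (γ 0) (γ b) ≤
      ENNReal.ofReal (C * b) := by
  let : Bundle.RiemannianBundle (fun x : M ↦ TangentSpace 𝓘(ℝ, E) x) :=
    ⟨(SmoothMetric.ofImmersion f hf himm).toContinuousRiemannianMetric.toRiemannianMetric⟩
  change Manifold.riemannianEDist 𝓘(ℝ, E) (γ 0) (γ b) ≤ _
  refine (Manifold.riemannianEDist_le_pathELength hγ.contMDiffOn rfl rfl hb).trans ?_
  rw [Manifold.pathELength_eq_lintegral_mfderiv_Icc]
  have hC0 : 0 ≤ C := (norm_nonneg _).trans (hC 0)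
  have h1 : ∀ s, ‖mfderiv 𝓘(ℝ, ℝ) 𝓘(ℝ, E) γ s 1‖ₑ ≤ ENNReal.ofReal C := by
    intro s
    rw [SmoothMetric.enorm_ofImmersion hf himm]
    have h2 := mfderiv_comp s (hf.mdifferentiable (by simp) (γ s))
      (hγ.mdifferentiable (by simp) s)
    rw [mfderiv_eq_fderiv] at h2
    have h3 : deriv (f ∘ γ) s = modelDeriv E f (γ s) (mfderiv 𝓘(ℝ, ℝ) 𝓘(ℝ, E) γ s 1) :=
      DFunLike.congr_fun h2 1
    rw [← h3, ← ofReal_norm]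
    exact ENNReal.ofReal_le_ofReal (hC s)
  refine (MeasureTheory.lintegral_mono fun s ↦ h1 s).trans ?_
  rw [MeasureTheory.setLIntegral_const, Real.volume_Icc, sub_zero, ENNReal.ofReal_mul hC0]

/-- A 1-Lipschitz map does not lengthen curves, and a curve in a unit sphere is at least as long as
the angle between its ends. -/
theorem SmoothMetric.angle_le_edist_ofImmersion {ψ : V → W} (hψ : LipschitzWith 1 ψ)
    (hψf : ∀ x, ContDiffAt ℝ 1 ψ (f x)) (hnorm : ∀ x, ‖ψ (f x)‖ = 1) (x y : M) :
    ENNReal.ofReal (InnerProductGeometry.angle (ψ (f x)) (ψ (f y))) ≤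
      (SmoothMetric.ofImmersion f hf himm).emetricSpace.edist x y := by
  let : Bundle.RiemannianBundle (fun x : M ↦ TangentSpace 𝓘(ℝ, E) x) :=
    ⟨(SmoothMetric.ofImmersion f hf himm).toContinuousRiemannianMetric.toRiemannianMetric⟩
  change _ ≤ Manifold.riemannianEDist 𝓘(ℝ, E) x y
  refine le_of_forall_gt fun r hr ↦ ?_
  obtain ⟨γ, rfl, rfl, hγ, hlt⟩ := Manifold.exists_lt_of_riemannianEDist_lt hr
  refine lt_of_le_of_lt ?_ hlt
  rw [Manifold.pathELength_eq_lintegral_mfderivWithin_Icc]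
  have hc : ContDiffOn ℝ 1 (f ∘ γ) (Icc 0 1) :=
    contMDiffOn_iff_contDiffOn.1 ((hf.of_le (by simp)).comp_contMDiffOn hγ)
  have hU : ContDiffOn ℝ 1 (fun s ↦ ψ (f (γ s))) (Icc 0 1) := fun s hs ↦
    (hψf (γ s)).comp_contDiffWithinAt s (hc s hs)
  refine (angle_le_lintegral_derivWithin hU fun s _ ↦ hnorm _).trans ?_
  refine MeasureTheory.setLIntegral_mono' measurableSet_Icc fun s hs ↦ ?_
  rw [SmoothMetric.enorm_ofImmersion hf himm]
  have hud : UniqueDiffWithinAt ℝ (Icc (0 : ℝ) 1) s := uniqueDiffOn_Icc zero_lt_one s hs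
  have h2 := mfderiv_comp_mfderivWithin s (hf.mdifferentiable (by simp) (γ s))
    (hγ.mdifferentiableOn (by simp) s hs) hud.uniqueMDiffWithinAt
  rw [mfderivWithin_eq_fderivWithin] at h2
  have h3 : derivWithin (f ∘ γ) (Icc 0 1) s =
      modelDeriv E f (γ s) (mfderivWithin 𝓘(ℝ, ℝ) 𝓘(ℝ, E) γ (Icc 0 1) s 1) :=
    DFunLike.congr_fun h2 1
  rw [← h3]
  have hd := ((hψf (γ s)).differentiableAt (by simp)).hasFDerivAt.comp_hasDerivWithinAt s
    (hc.differentiableOn (by simp) s hs).hasDerivWithinAt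
  rw [show (fun s ↦ ψ (f (γ s))) = ψ ∘ (f ∘ γ) from rfl, hd.derivWithin hud,
    enorm_le_iff_norm_le]
  refine (ContinuousLinearMap.le_opNorm _ _).trans ?_
  have h4 : ‖fderiv ℝ ψ (f (γ s))‖ ≤ 1 := by
    simpa using norm_fderiv_le_of_lipschitz ℝ hψ (x₀ := f (γ s))
  exact mul_le_of_le_one_left (norm_nonneg _) h4

end Distance

/-! ## Comparison of the induced distance with the distance of the hemisphere -/

section Comparison

variable {P Q : Type*} [NormedAddCommGroup P] [InnerProductSpace ℝ P]
  [NormedAddCommGroup Q] [InnerProductSpace ℝ Q]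

/-- The map `(x, y, z) ↦ (x, √(|y|² + z²))`. -/
def foldMap (X : WithLp 2 (WithLp 2 (P × Q) × ℝ)) : WithLp 2 (P × ℝ) :=
  WithLp.toLp 2 (X.fst.fst, ‖(WithLp.toLp 2 (X.fst.snd, X.snd) : WithLp 2 (Q × ℝ))‖)

/-- The map `(x, y) ↦ (x, |y|)`. -/
def flatten (X : WithLp 2 (P × Q)) : WithLp 2 (P × ℝ) := WithLp.toLp 2 (X.fst, ‖X.snd‖)

omit [InnerProductSpace ℝ P] [InnerProductSpace ℝ Q] in
theorem lipschitzWith_foldMap :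
    LipschitzWith 1 (foldMap : WithLp 2 (WithLp 2 (P × Q) × ℝ) → WithLp 2 (P × ℝ)) := by
  refine LipschitzWith.mk_one fun X Y ↦ ?_
  rw [dist_eq_norm, dist_eq_norm]
  refine (sq_le_sq₀ (norm_nonneg _) (norm_nonneg _)).1 ?_
  rw [WithLp.prod_norm_sq_eq_of_L2, WithLp.prod_norm_sq_eq_of_L2 (X - Y),
    WithLp.prod_norm_sq_eq_of_L2 (X - Y).fst]
  have h := abs_norm_sub_norm_le (WithLp.toLp 2 (X.fst.snd, X.snd) : WithLp 2 (Q × ℝ))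
    (WithLp.toLp 2 (Y.fst.snd, Y.snd))
  have h2 := pow_le_pow_left₀ (abs_nonneg _) h 2
  rw [WithLp.prod_norm_sq_eq_of_L2 (_ - _)] at h2
  rw [add_assoc]
  exact add_le_add le_rfl h2

/-- The norm of `(y, z)` is singular only at the origin, which the positive height on the cone
avoids. -/
theorem contDiffAt_foldMap {X : WithLp 2 (WithLp 2 (P × Q) × ℝ)} (hX : X.snd ≠ 0) :
    ContDiffAt ℝ 1 (foldMap : WithLp 2 (WithLp 2 (P × Q) × ℝ) → WithLp 2 (P × ℝ)) X := by
  have h1 : ContDiff ℝ 1 fun X : WithLp 2 (WithLp 2 (P × Q) × ℝ) ↦ X.fst.fst :=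
    (WithLp.fstL 2 ℝ P Q ∘L WithLp.fstL 2 ℝ (WithLp 2 (P × Q)) ℝ).contDiff
  have h2 : ContDiff ℝ 1 fun X : WithLp 2 (WithLp 2 (P × Q) × ℝ) ↦ X.fst.snd :=
    (WithLp.sndL 2 ℝ P Q ∘L WithLp.fstL 2 ℝ (WithLp 2 (P × Q)) ℝ).contDiff
  have h3 : ContDiff ℝ 1 fun X : WithLp 2 (WithLp 2 (P × Q) × ℝ) ↦ X.snd :=
    (WithLp.sndL 2 ℝ (WithLp 2 (P × Q)) ℝ).contDiff
  have h4 : ContDiff ℝ 1 fun X : WithLp 2 (WithLp 2 (P × Q) × ℝ) ↦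
      (WithLp.toLp 2 (X.fst.snd, X.snd) : WithLp 2 (Q × ℝ)) :=
    WithLp.contDiff_toLp.comp (h2.prodMk h3)
  have h5 := h4.contDiffAt.norm ℝ (x := X) fun h ↦ hX (congrArg WithLp.snd h)
  exact WithLp.contDiff_toLp.contDiffAt.comp X (h1.contDiffAt.prodMk h5)

omit [InnerProductSpace ℝ P] [InnerProductSpace ℝ Q] in
theorem norm_foldMap (X : WithLp 2 (WithLp 2 (P × Q) × ℝ)) : ‖foldMap X‖ = ‖X‖ := by
  refine (pow_left_inj₀ (norm_nonneg _) (norm_nonneg _) two_ne_zero).1 ?_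
  rw [WithLp.prod_norm_sq_eq_of_L2, WithLp.prod_norm_sq_eq_of_L2 X,
    WithLp.prod_norm_sq_eq_of_L2 X.fst]
  change ‖X.fst.fst‖ ^ 2 + ‖‖(WithLp.toLp 2 (X.fst.snd, X.snd) : WithLp 2 (Q × ℝ))‖‖ ^ 2 = _
  rw [norm_norm, WithLp.prod_norm_sq_eq_of_L2 (WithLp.toLp 2 _), add_assoc]
  rfl

omit [InnerProductSpace ℝ P] [InnerProductSpace ℝ Q] in
theorem norm_flatten (X : WithLp 2 (P × Q)) : ‖flatten X‖ = ‖X‖ := by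
  refine (pow_left_inj₀ (norm_nonneg _) (norm_nonneg _) two_ne_zero).1 ?_
  rw [WithLp.prod_norm_sq_eq_of_L2, WithLp.prod_norm_sq_eq_of_L2 X]
  change ‖X.fst‖ ^ 2 + ‖‖X.snd‖‖ ^ 2 = _
  rw [norm_norm]

/-- The folded point is `(x, s)/√(1 + t)` with `s ≥ |y|`, so its inner product with the unit vector
`(x, |y|)` is at least `1/√(1 + t)`. -/
theorem angle_foldMap_coneMap_flatten_le {t : ℝ} (ht : 0 ≤ t) {X : WithLp 2 (P × Q)}
    (hX : ‖X‖ = 1) :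
    InnerProductGeometry.angle (foldMap (coneMap t X)) (flatten X) ≤
      Real.arccos (√(1 + t))⁻¹ := by
  have hc : 0 ≤ (√(1 + t))⁻¹ := by positivity
  have h1 : foldMap (coneMap t X) = (√(1 + t))⁻¹ • WithLp.toLp 2 (X.fst,
      ‖(WithLp.toLp 2 (√t • X.snd, coneHeight t X) : WithLp 2 (Q × ℝ))‖) := by
    refine WithLp.ofLp_injective 2 (Prod.ext ?_ ?_)
    · change (√(1 + t))⁻¹ • (1 : ℝ) • X.fst = (√(1 + t))⁻¹ • X.fst
      rw [one_smul]
    · change ‖(√(1 + t))⁻¹ • (WithLp.toLp 2 (√t • X.snd, coneHeight t X) : WithLp 2 (Q × ℝ))‖ = _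
      rw [norm_smul, Real.norm_of_nonneg hc]
      rfl
  have h2 : ‖X.snd‖ ≤ ‖(WithLp.toLp 2 (√t • X.snd, coneHeight t X) : WithLp 2 (Q × ℝ))‖ := by
    refine le_trans ?_ (WithLp.norm_snd_le _ _)
    refine le_trans (Real.le_sqrt_of_sq_le ?_) (le_abs_self _)
    have := mul_nonneg ht (sq_nonneg ‖X.fst‖)
    linarith
  unfold InnerProductGeometry.angle
  refine Real.antitone_arccos ?_
  rw [norm_foldMap, norm_coneMap ht, norm_flatten, hX, mul_one, div_one, h1, inner_smul_left,
    conj_trivial]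
  refine le_mul_of_one_le_right hc ?_
  rw [WithLp.prod_inner_apply]
  change 1 ≤ inner ℝ X.fst X.fst + inner ℝ _ ‖X.snd‖
  have h3 := WithLp.prod_norm_sq_eq_of_L2 X
  rw [hX] at h3
  rw [real_inner_self_eq_norm_sq]
  change 1 ≤ ‖X.fst‖ ^ 2 + ‖X.snd‖ *
    ‖(WithLp.toLp 2 (√t • X.snd, coneHeight t X) : WithLp 2 (Q × ℝ))‖
  nlinarith [mul_le_mul_of_nonneg_left h2 (norm_nonneg X.snd)]

theorem norm_coneMapDeriv_sq (t : ℝ) (ht : 0 ≤ t) (X v : WithLp 2 (P × Q)) :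
    ‖coneMapDeriv t X v‖ ^ 2 =
      (1 + t)⁻¹ * (‖v.fst‖ ^ 2 + t * ‖v.snd‖ ^ 2 + coneHeightDeriv t X v ^ 2) := by
  rw [coneMapDeriv_apply, norm_smul, mul_pow, WithLp.prod_norm_sq_eq_of_L2, WithLp.toLp_fst,
    WithLp.toLp_snd, WithLp.prod_norm_sq_eq_of_L2 (scaleSum _ _ v), scaleSum_fst, scaleSum_snd,
    one_smul, norm_smul, mul_pow, norm_inv, inv_pow, Real.norm_eq_abs, Real.norm_eq_abs √t,
    Real.norm_eq_abs (coneHeightDeriv t X v), sq_abs, sq_abs, sq_abs, Real.sq_sqrt (by positivity),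
    Real.sq_sqrt ht]

/-- On the unit sphere `coneMap t` does not increase lengths. -/
theorem norm_coneMapDeriv_le {t : ℝ} (ht : 0 < t) (ht1 : t ≤ 1) {X v : WithLp 2 (P × Q)}
    (hX : X ≠ 0) (hv : inner ℝ X v = 0) : ‖coneMapDeriv t X v‖ ≤ ‖v‖ := by
  refine (sq_le_sq₀ (norm_nonneg _) (norm_nonneg _)).1 ?_
  rw [norm_coneMapDeriv_sq t ht.le, WithLp.prod_norm_sq_eq_of_L2 v]
  rw [WithLp.prod_inner_apply] at hv
  have hv' : inner ℝ X.fst v.fst = -inner ℝ X.snd v.snd := by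
    change inner ℝ X.fst v.fst + inner ℝ X.snd v.snd = 0 at hv
    linarith
  have hpos := coneHeight_pos ht hX
  have hsq := coneHeight_sq ht.le X
  -- Tangency to the sphere trades the `x` term for the `y` term. The factor `1 - t` it leaves is
  -- exactly what `t‖v.snd‖²` needs to complete `‖v.snd‖²`.
  have hd : coneHeightDeriv t X v * coneHeight t X = (1 - t) * inner ℝ X.snd v.snd := by
    rw [coneHeightDeriv_apply, hv']
    field_simp
    ring
  have h1 : coneHeightDeriv t X v ^ 2 ≤ (1 - t) * ‖v.snd‖ ^ 2 := by
    have h2 : (inner ℝ X.snd v.snd) ^ 2 ≤ ‖X.snd‖ ^ 2 * ‖v.snd‖ ^ 2 := by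
      rw [← mul_pow, ← sq_abs]
      exact pow_le_pow_left₀ (abs_nonneg _) (abs_real_inner_le_norm _ _) 2
    have h3 : coneHeightDeriv t X v ^ 2 * coneHeight t X ^ 2 =
        (1 - t) ^ 2 * (inner ℝ X.snd v.snd) ^ 2 := by
      rw [← mul_pow, hd, mul_pow]
    have h4 : 0 < coneHeight t X ^ 2 := by positivity
    refine le_of_mul_le_mul_right (h3.trans_le ?_) h4
    rw [hsq]
    have h5 : (1 - t) ^ 2 ≤ 1 - t := by nlinarith
    calc (1 - t) ^ 2 * (inner ℝ X.snd v.snd) ^ 2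
        ≤ (1 - t) * (‖X.snd‖ ^ 2 * ‖v.snd‖ ^ 2) :=
          mul_le_mul h5 h2 (sq_nonneg _) (by linarith)
      _ ≤ (1 - t) * (‖X.snd‖ ^ 2 * ‖v.snd‖ ^ 2) + (1 - t) * (t * ‖X.fst‖ ^ 2 * ‖v.snd‖ ^ 2) :=
          le_add_of_nonneg_right (mul_nonneg (by linarith) (by positivity))
      _ = (1 - t) * ‖v.snd‖ ^ 2 * (t * ‖X.fst‖ ^ 2 + ‖X.snd‖ ^ 2) := by ring
  have h6 : (1 + t)⁻¹ ≤ 1 := inv_le_one_of_one_le₀ (by linarith)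
  calc (1 + t)⁻¹ * (‖v.fst‖ ^ 2 + t * ‖v.snd‖ ^ 2 + coneHeightDeriv t X v ^ 2)
      ≤ 1 * (‖v.fst‖ ^ 2 + t * ‖v.snd‖ ^ 2 + coneHeightDeriv t X v ^ 2) := by gcongr
    _ ≤ ‖v.fst‖ ^ 2 + ‖v.snd‖ ^ 2 := by linarith

/-- Rotations of the second factor are strongly contracted by `coneMap t`. -/
theorem norm_coneMapDeriv_le_of_fst_eq_zero {t : ℝ} (ht : 0 < t) {X v : WithLp 2 (P × Q)}
    (hv : v.fst = 0) (hv' : inner ℝ X.snd v.snd = 0) :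
    ‖coneMapDeriv t X v‖ ≤ √t * ‖v.snd‖ := by
  refine (sq_le_sq₀ (norm_nonneg _) (by positivity)).1 ?_
  rw [norm_coneMapDeriv_sq t ht.le, coneHeightDeriv_apply, hv, hv', mul_pow √t, Real.sq_sqrt ht.le]
  have h6 : (1 + t)⁻¹ ≤ 1 := inv_le_one_of_one_le₀ (by linarith)
  simp only [norm_zero, inner_zero_right, mul_zero, add_zero]
  have h7 : 0 ≤ t * ‖v.snd‖ ^ 2 := by positivity
  nlinarith

/-- A unit vector `b` is reached from a unit vector `a` along a great circle. -/
theorem exists_great_circle {H : Type*} [NormedAddCommGroup H] [InnerProductSpace ℝ H]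
    [FiniteDimensional ℝ H] (hH : 2 ≤ Module.finrank ℝ H) {a b : H} (ha : ‖a‖ = 1)
    (hb : ‖b‖ = 1) :
    ∃ e : H, ‖e‖ = 1 ∧ inner ℝ a e = 0 ∧ Real.cos (InnerProductGeometry.angle a b) • a
      + Real.sin (InnerProductGeometry.angle a b) • e = b := by
  set φ := InnerProductGeometry.angle a b
  have hcos : Real.cos φ = inner ℝ a b := by
    rw [InnerProductGeometry.cos_angle, ha, hb, mul_one, div_one]
  have hsin : 0 ≤ Real.sin φ := InnerProductGeometry.sin_angle_nonneg a b
  set w := b - Real.cos φ • a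
  have haw : inner ℝ a w = 0 := by
    rw [inner_sub_right, inner_smul_right, real_inner_self_eq_norm_sq, ha, hcos]
    ring
  have hw : ‖w‖ = Real.sin φ := by
    refine (pow_left_inj₀ (norm_nonneg _) hsin two_ne_zero).1 ?_
    rw [norm_sub_sq_real, inner_smul_right, norm_smul, mul_pow, ha, hb, real_inner_comm, ← hcos,
      Real.norm_eq_abs, sq_abs, Real.sin_sq]
    ring
  by_cases h0 : w = 0
  -- Here `b = ±a` and the sine vanishes, so any unit vector orthogonal to `a` will do; dimension at
  -- least two provides one.
  · have hne : (Submodule.span ℝ {a})ᗮ ≠ ⊥ := by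
      intro h
      have h1 := (Submodule.span ℝ {a}).finrank_add_finrank_orthogonal
      rw [h, finrank_bot, finrank_span_singleton (norm_ne_zero_iff.1 (by simp [ha]))] at h1
      omega
    obtain ⟨e, he, hne⟩ := Submodule.exists_mem_ne_zero_of_ne_bot hne
    have hn : ‖e‖ ≠ 0 := norm_ne_zero_iff.2 hne
    refine ⟨‖e‖⁻¹ • e, by rw [norm_smul, norm_inv, norm_norm, inv_mul_cancel₀ hn], ?_, ?_⟩
    · rw [inner_smul_right, Submodule.mem_orthogonal_singleton_iff_inner_right.1 he, mul_zero]
    · rw [← hw, h0, norm_zero, zero_smul, add_zero]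
      exact (sub_eq_zero.1 h0).symm
  · have hn : ‖w‖ ≠ 0 := norm_ne_zero_iff.2 h0
    refine ⟨‖w‖⁻¹ • w, by rw [norm_smul, norm_inv, norm_norm, inv_mul_cancel₀ hn], ?_, ?_⟩
    · rw [inner_smul_right, haw, mul_zero]
    · rw [← hw, smul_inv_smul₀ hn]
      exact add_sub_cancel _ _

theorem norm_cos_smul_add_sin_smul {H : Type*} [NormedAddCommGroup H] [InnerProductSpace ℝ H]
    {a e : H} (ha : ‖a‖ = 1) (he : ‖e‖ = 1) (hae : inner ℝ a e = 0) (s : ℝ) :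
    ‖Real.cos s • a + Real.sin s • e‖ = 1 := by
  refine (pow_left_inj₀ (norm_nonneg _) zero_le_one two_ne_zero).1 ?_
  rw [norm_add_sq_real, inner_smul_left, inner_smul_right, hae, norm_smul, norm_smul, ha, he,
    Real.norm_eq_abs, Real.norm_eq_abs, mul_one, mul_one, sq_abs, sq_abs]
  simp

theorem hasDerivAt_cos_smul_add_sin_smul {H : Type*} [NormedAddCommGroup H] [NormedSpace ℝ H]
    (a e : H) (s : ℝ) : HasDerivAt (fun s ↦ Real.cos s • a + Real.sin s • e)
      (Real.cos s • e + Real.sin s • (-a)) s := by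
  have h := ((Real.hasDerivAt_cos s).smul_const a).add ((Real.hasDerivAt_sin s).smul_const e)
  refine h.congr_deriv ?_
  rw [smul_neg, neg_smul, add_comm]

theorem inner_cos_smul_add_sin_smul {H : Type*} [NormedAddCommGroup H] [InnerProductSpace ℝ H]
    {a e : H} (ha : ‖a‖ = 1) (he : ‖e‖ = 1) (hae : inner ℝ a e = 0) (s : ℝ) :
    inner ℝ (Real.cos s • a + Real.sin s • e) (Real.cos s • e + Real.sin s • (-a)) = 0 := by
  have hea : inner ℝ e a = 0 := by rw [real_inner_comm, hae]
  simp only [inner_add_left, inner_add_right, inner_smul_left, inner_smul_right, inner_neg_right,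
    hae, hea, real_inner_self_eq_norm_sq, ha, he, conj_trivial]
  ring

theorem contDiff_cos_smul_add_sin_smul {H : Type*} [NormedAddCommGroup H] [NormedSpace ℝ H]
    (a e : H) {n : ℕ∞ω} : ContDiff ℝ n fun s ↦ Real.cos s • a + Real.sin s • e :=
  (Real.contDiff_cos.smul contDiff_const).add (Real.contDiff_sin.smul contDiff_const)

end Comparison

/-! ### Distance estimates for the cone metrics and the quotient map to the hemisphere -/

section Hemisphere

/-- A shortcut: the search through the product topology is slow. -/
instance continuousSMul_splitSpace (p q : ℕ) : ContinuousSMul ℝ (SplitSpace p q) :=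
  IsBoundedSMul.continuousSMul

/-- A shortcut: the search through the product topology is slow. -/
instance continuousSMul_splitSpace_prod_real (p q : ℕ) :
    ContinuousSMul ℝ (WithLp 2 (SplitSpace p q × ℝ)) :=
  IsBoundedSMul.continuousSMul

variable {p q : ℕ} [Fact (2 ≤ p)]

theorem edist_coneMetric_le_of_curve {t : ℝ} (ht : 0 < t) {c c' : ℝ → SplitSpace p q}
    (hc : ContDiff ℝ 1 c) (hn : ∀ s, ‖c s‖ = 1) (hd : ∀ s, HasDerivAt c (c' s) s) {C b : ℝ}
    (hb : 0 ≤ b) (hC : ∀ s, ‖coneMapDeriv t (c s) (c' s)‖ ≤ C) {x y : SplitSphere p q}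
    (hx : c 0 = x) (hy : c b = y) :
    (coneMetric p q ht).emetricSpace.edist x y ≤ ENNReal.ofReal (C * b) := by
  have hmem : ∀ s, c s ∈ Metric.sphere (0 : SplitSpace p q) 1 := fun s ↦ by simp [hn s]
  let γ : ℝ → SplitSphere p q := codRestrict c _ hmem
  have hγ : ContMDiff 𝓘(ℝ, ℝ) 𝓘(ℝ, EuclideanSpace ℝ (Fin (p + q - 1))) 1 γ :=
    hc.contMDiff.codRestrict_sphere hmem
  obtain rfl : γ 0 = x := Subtype.ext hx
  obtain rfl : γ b = y := Subtype.ext hy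
  refine SmoothMetric.edist_ofImmersion_le _ _ hγ hb fun s ↦ ?_
  have h : HasDerivAt (coneImmersion t ∘ γ) (coneMapDeriv t (c s) (c' s)) s :=
    (hasFDerivAt_coneMap ht (SplitSphere.ne_zero (γ s))).comp_hasDerivAt s (hd s)
  rw [h.deriv]
  exact hC s

/-- Measure the great circle from `x` to `y`: it has unit speed in the round metric, which `coneMap
t` does not increase. -/
theorem edist_coneMetric_le_angle {t : ℝ} (ht : 0 < t) (ht1 : t ≤ 1) (x y : SplitSphere p q) :
    (coneMetric p q ht).emetricSpace.edist x y ≤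
      ENNReal.ofReal (InnerProductGeometry.angle (x : SplitSpace p q) (y : SplitSpace p q)) := by
  have hp : 2 ≤ p := Fact.out
  have hx := norm_eq_of_mem_sphere x
  have hy := norm_eq_of_mem_sphere y
  obtain ⟨e, he, hxe, hxy⟩ := exists_great_circle
    (by rw [finrank_splitSpace]; omega) hx hy
  have h := edist_coneMetric_le_of_curve ht (contDiff_cos_smul_add_sin_smul (x : SplitSpace p q) e)
    (norm_cos_smul_add_sin_smul hx he hxe) (hasDerivAt_cos_smul_add_sin_smul _ e)
    (InnerProductGeometry.angle_nonneg (x : SplitSpace p q) (y : SplitSpace p q)) (C := 1)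
    (fun s ↦ ?_) (x := x) (y := y) (by simp) hxy
  · rwa [one_mul] at h
  · have hne : Real.cos s • (x : SplitSpace p q) + Real.sin s • e ≠ 0 :=
      norm_ne_zero_iff.1 (by rw [norm_cos_smul_add_sin_smul hx he hxe]; exact one_ne_zero)
    refine (norm_coneMapDeriv_le ht ht1 hne (inner_cos_smul_add_sin_smul hx he hxe s)).trans ?_
    refine (norm_cos_smul_add_sin_smul he (by rwa [norm_neg]) ?_ s).le
    rw [inner_neg_right, real_inner_comm, hxe, neg_zero]

/-- Points that differ by a rotation of the second factor are close for the metric of parameter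
`t`. -/
theorem edist_coneMetric_le_of_rotation {t : ℝ} (ht : 0 < t) (hq : 2 ≤ q) {x y : SplitSphere p q}
    {r : ℝ} {a b : EuclideanSpace ℝ (Fin q)} (ha : ‖a‖ = 1) (hb : ‖b‖ = 1)
    (hfst : (x : SplitSpace p q).fst = (y : SplitSpace p q).fst)
    (hx : (x : SplitSpace p q).snd = r • a) (hy : (y : SplitSpace p q).snd = r • b) :
    (coneMetric p q ht).emetricSpace.edist x y ≤ ENNReal.ofReal (√t * Real.pi) := by
  obtain ⟨e, he, hae, hab⟩ := exists_great_circle (by rw [finrank_euclideanSpace_fin]; exact hq)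
    ha hb
  have hr1 : |r| ≤ 1 := by
    have h1 := WithLp.norm_snd_le _ (x : SplitSpace p q)
    rw [norm_eq_of_mem_sphere] at h1
    have h2 : ‖(x : SplitSpace p q).snd‖ ≤ 1 := h1
    rwa [hx, norm_smul, ha, mul_one] at h2
  let c : ℝ → SplitSpace p q := fun s ↦
    WithLp.toLp 2 ((x : SplitSpace p q).fst, r • (Real.cos s • a + Real.sin s • e))
  let c' : ℝ → SplitSpace p q := fun s ↦
    WithLp.toLp 2 (0, r • (Real.cos s • e + Real.sin s • (-a)))
  have hc : ContDiff ℝ 1 c := WithLp.contDiff_toLp.comp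
    (contDiff_const.prodMk ((contDiff_cos_smul_add_sin_smul a e).const_smul r))
  have hd : ∀ s, HasDerivAt c (c' s) s := fun s ↦
    ((WithLp.prodContinuousLinearEquiv 2 ℝ (EuclideanSpace ℝ (Fin p))
      (EuclideanSpace ℝ (Fin q))).symm.hasFDerivAt).comp_hasDerivAt s
      ((hasDerivAt_const s _).prodMk ((hasDerivAt_cos_smul_add_sin_smul a e s).const_smul r))
  have hn : ∀ s, ‖c s‖ = 1 := by
    intro s
    refine (pow_left_inj₀ (norm_nonneg _) zero_le_one two_ne_zero).1 ?_
    have hx2 := WithLp.prod_norm_sq_eq_of_L2 (x : SplitSpace p q)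
    rw [norm_eq_of_mem_sphere, hx] at hx2
    rw [hx2, WithLp.prod_norm_sq_eq_of_L2]
    change ‖(x : SplitSpace p q).fst‖ ^ 2 + ‖r • (Real.cos s • a + Real.sin s • e)‖ ^ 2 = _
    rw [norm_smul, norm_smul, norm_cos_smul_add_sin_smul ha he hae, ha]
  have h := edist_coneMetric_le_of_curve ht hc hn hd
    (InnerProductGeometry.angle_nonneg a b) (C := √t) (fun s ↦ ?_) (x := x) (y := y) ?_ ?_
  · exact h.trans (ENNReal.ofReal_le_ofReal
      (mul_le_mul_of_nonneg_left (InnerProductGeometry.angle_le_pi a b) (Real.sqrt_nonneg t)))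
  · refine (norm_coneMapDeriv_le_of_fst_eq_zero ht rfl ?_).trans ?_
    · change inner ℝ (r • (Real.cos s • a + Real.sin s • e))
        (r • (Real.cos s • e + Real.sin s • (-a))) = 0
      rw [inner_smul_left, inner_smul_right, inner_cos_smul_add_sin_smul ha he hae, mul_zero,
        mul_zero]
    · refine mul_le_of_le_one_right (Real.sqrt_nonneg t) ?_
      change ‖r • (Real.cos s • e + Real.sin s • (-a))‖ ≤ 1
      rw [norm_smul, norm_cos_smul_add_sin_smul he (by rwa [norm_neg])
        (by rw [inner_neg_right, real_inner_comm, hae, neg_zero]), mul_one]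
      exact hr1
  · refine WithLp.ofLp_injective 2 (Prod.ext rfl ?_)
    change r • (Real.cos 0 • a + Real.sin 0 • e) = (x : SplitSpace p q).snd
    rw [hx]; simp
  · refine WithLp.ofLp_injective 2 (Prod.ext hfst ?_)
    change r • (Real.cos _ • a + Real.sin _ • e) = (y : SplitSpace p q).snd
    rw [hy, hab]

/-- First rotate the second component of `x` into the direction of that of `y`, at cost `√t π`. Then
follow a great circle: once the second components are aligned, the angle equals that of the
flattened points. -/
theorem edist_coneMetric_le {t : ℝ} (ht : 0 < t) (ht1 : t ≤ 1) (hq : 2 ≤ q)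
    (x y : SplitSphere p q) :
    (coneMetric p q ht).emetricSpace.edist x y ≤
      ENNReal.ofReal (√t * Real.pi) + ENNReal.ofReal
        (InnerProductGeometry.angle (flatten (x : SplitSpace p q)) (flatten (y : SplitSpace p q))) := by
  have hdir : ∀ v : EuclideanSpace ℝ (Fin q), ∃ a, ‖a‖ = 1 ∧ v = ‖v‖ • a := by
    intro v
    by_cases hv : v = 0
    -- A zero second component has no direction; any unit vector serves.
    · exact ⟨EuclideanSpace.single ⟨0, by omega⟩ 1, by simp, by simp [hv]⟩
    · have hn : ‖v‖ ≠ 0 := norm_ne_zero_iff.2 hv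
      exact ⟨‖v‖⁻¹ • v, by rw [norm_smul, norm_inv, norm_norm, inv_mul_cancel₀ hn],
        (smul_inv_smul₀ hn v).symm⟩
  obtain ⟨a, ha, hxa⟩ := hdir (x : SplitSpace p q).snd
  obtain ⟨b, hb, hyb⟩ := hdir (y : SplitSpace p q).snd
  set r := ‖(x : SplitSpace p q).snd‖ with hr
  let w : SplitSpace p q := WithLp.toLp 2 ((x : SplitSpace p q).fst, r • b)
  have hw : ‖w‖ = 1 := by
    refine (pow_left_inj₀ (norm_nonneg _) zero_le_one two_ne_zero).1 ?_
    have hx2 := WithLp.prod_norm_sq_eq_of_L2 (x : SplitSpace p q)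
    rw [norm_eq_of_mem_sphere] at hx2
    rw [hx2, WithLp.prod_norm_sq_eq_of_L2]
    change ‖(x : SplitSpace p q).fst‖ ^ 2 + ‖r • b‖ ^ 2 = _
    rw [norm_smul, hb, mul_one, hr, norm_norm]
  let z : SplitSphere p q := ⟨w, by simp [hw]⟩
  have hang : InnerProductGeometry.angle (flatten (x : SplitSpace p q))
      (flatten (y : SplitSpace p q)) =
      InnerProductGeometry.angle (z : SplitSpace p q) (y : SplitSpace p q) := by
    unfold InnerProductGeometry.angle
    rw [norm_flatten, norm_flatten, norm_eq_of_mem_sphere x, norm_eq_of_mem_sphere y,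
      norm_eq_of_mem_sphere z, WithLp.prod_inner_apply, WithLp.prod_inner_apply]
    change Real.arccos ((inner ℝ (x : SplitSpace p q).fst (y : SplitSpace p q).fst
      + inner ℝ r ‖(y : SplitSpace p q).snd‖) / _) =
      Real.arccos ((inner ℝ (x : SplitSpace p q).fst (y : SplitSpace p q).fst
      + inner ℝ (r • b) (y : SplitSpace p q).snd) / _)
    congr 3
    conv_rhs => rw [hyb]
    rw [inner_smul_left, inner_smul_right, real_inner_self_eq_norm_sq, hb]
    simp [mul_comm]
  refine (@edist_triangle _ (coneMetric p q ht).emetricSpace.toPseudoEMetricSpace x z y).trans (add_le_add ?_ ?_)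
  · exact edist_coneMetric_le_of_rotation ht hq ha hb rfl hxa rfl
  · rw [hang]
    exact edist_coneMetric_le_angle ht ht1 z y

/-- The distance dominates the angle between the folded images; replacing each of the two by its
flattened point costs one `arccos` term. -/
theorem angle_flatten_le_edist_coneMetric {t : ℝ} (ht : 0 < t) (x y : SplitSphere p q) :
    ENNReal.ofReal (InnerProductGeometry.angle (flatten (x : SplitSpace p q))
      (flatten (y : SplitSpace p q)) - 2 * Real.arccos (√(1 + t))⁻¹) ≤
      (coneMetric p q ht).emetricSpace.edist x y := by
  have hx := norm_eq_of_mem_sphere x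
  have hy := norm_eq_of_mem_sphere y
  refine le_trans (ENNReal.ofReal_le_ofReal ?_)
    (SmoothMetric.angle_le_edist_ofImmersion (contMDiff_coneImmersion ht)
      (modelDeriv_coneImmersion_injective ht) (ψ := foldMap) lipschitzWith_foldMap (fun z ↦ ?_)
      (fun z ↦ ?_) x y)
  · have h1 := angle_foldMap_coneMap_flatten_le ht.le hx
    have h2 := angle_foldMap_coneMap_flatten_le ht.le hy
    have h3 := InnerProductGeometry.angle_le_angle_add_angle (flatten (x : SplitSpace p q))
      (foldMap (coneMap t (x : SplitSpace p q))) (flatten (y : SplitSpace p q))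
    have h4 := InnerProductGeometry.angle_le_angle_add_angle
      (foldMap (coneMap t (x : SplitSpace p q))) (foldMap (coneMap t (y : SplitSpace p q)))
      (flatten (y : SplitSpace p q))
    rw [InnerProductGeometry.angle_comm (flatten (x : SplitSpace p q))
      (foldMap (coneMap t (x : SplitSpace p q)))] at h3
    change _ ≤ InnerProductGeometry.angle (foldMap (coneMap t (x : SplitSpace p q)))
      (foldMap (coneMap t (y : SplitSpace p q)))
    linarith
  · refine contDiffAt_foldMap ?_
    have h : 0 < (√(1 + t))⁻¹ * coneHeight t (z : SplitSpace p q) :=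
      mul_pos (inv_pos.2 (Real.sqrt_pos.2 (by positivity))) (coneHeight_pos ht z.ne_zero)
    exact h.ne'
  · rw [norm_foldMap, coneImmersion, norm_coneMap ht.le, norm_eq_of_mem_sphere]

/-- The quotient map of the sphere by the action of `O(q)`, with values in the hemisphere. -/
def toHemisphere (x : SplitSphere p q) : Hemisphere p :=
  ⟨WithLp.toLp 2 (Fin.cons ‖(x : SplitSpace p q).snd‖ (x : SplitSpace p q).fst), by
    constructor
    · refine (pow_left_inj₀ (norm_nonneg _) zero_le_one two_ne_zero).1 ?_
      have hx2 := WithLp.prod_norm_sq_eq_of_L2 (x : SplitSpace p q)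
      rw [norm_eq_of_mem_sphere, EuclideanSpace.norm_sq_eq (x : SplitSpace p q).fst] at hx2
      rw [hx2, EuclideanSpace.norm_sq_eq, Fin.sum_univ_succ]
      simp [add_comm]
    · simp⟩

omit [Fact (2 ≤ p)] in
theorem dist_toHemisphere (x y : SplitSphere p q) : dist (toHemisphere x) (toHemisphere y) =
    InnerProductGeometry.angle (flatten (x : SplitSpace p q)) (flatten (y : SplitSpace p q)) := by
  change InnerProductGeometry.angle (toHemisphere x).1 (toHemisphere y).1 = _
  unfold InnerProductGeometry.angle
  rw [norm_flatten, norm_flatten, norm_eq_of_mem_sphere x, norm_eq_of_mem_sphere y,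
    (toHemisphere x).2.1, (toHemisphere y).2.1, WithLp.prod_inner_apply]
  congr 2
  change ∑ i : Fin (p + 1), inner ℝ ((Fin.cons ‖(x : SplitSpace p q).snd‖
    (x : SplitSpace p q).fst : Fin (p + 1) → ℝ) i) ((Fin.cons ‖(y : SplitSpace p q).snd‖
    (y : SplitSpace p q).fst : Fin (p + 1) → ℝ) i) =
    inner ℝ (x : SplitSpace p q).fst (y : SplitSpace p q).fst
      + inner ℝ ‖(x : SplitSpace p q).snd‖ ‖(y : SplitSpace p q).snd‖
  rw [Fin.sum_univ_succ, PiLp.inner_apply, add_comm]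
  rfl

omit [Fact (2 ≤ p)] in
theorem toHemisphere_surjective (hq : 2 ≤ q) :
    Function.Surjective (toHemisphere : SplitSphere p q → Hemisphere p) := by
  rintro ⟨v, hv, hv0⟩
  have hs : ‖(EuclideanSpace.single ⟨0, by omega⟩ (v 0) : EuclideanSpace ℝ (Fin q))‖ = v 0 := by
    rw [PiLp.norm_single, Real.norm_of_nonneg hv0]
  let w : SplitSpace p q := WithLp.toLp 2 (WithLp.toLp 2 (Fin.tail v),
    EuclideanSpace.single ⟨0, by omega⟩ (v 0))
  have hw : ‖w‖ = 1 := by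
    refine (pow_left_inj₀ (norm_nonneg _) zero_le_one two_ne_zero).1 ?_
    rw [← hv, WithLp.prod_norm_sq_eq_of_L2, EuclideanSpace.norm_sq_eq v, Fin.sum_univ_succ]
    change ‖(WithLp.toLp 2 (Fin.tail v) : EuclideanSpace ℝ (Fin p))‖ ^ 2 +
      ‖(EuclideanSpace.single ⟨0, by omega⟩ (v 0) : EuclideanSpace ℝ (Fin q))‖ ^ 2 = _
    rw [hs, EuclideanSpace.norm_sq_eq, add_comm, Real.norm_eq_abs, sq_abs]
    rfl
  refine ⟨⟨w, by simp [hw]⟩, Subtype.ext (WithLp.ofLp_injective 2 ?_)⟩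
  change (Fin.cons ‖(EuclideanSpace.single ⟨0, by omega⟩ (v 0) : EuclideanSpace ℝ (Fin q))‖
    (Fin.tail v) : Fin (p + 1) → ℝ) = v
  rw [hs, Fin.cons_self_tail]

theorem abs_dist_coneMetric_sub_le {t : ℝ} (ht : 0 < t) (ht1 : t ≤ 1) (hq : 2 ≤ q)
    (x y : SplitSphere p q) :
    |(coneMetric p q ht).metricSpace.dist x y - dist (toHemisphere x) (toHemisphere y)| ≤
      √t * Real.pi + 2 * Real.arccos (√(1 + t))⁻¹ := by
  have hd : (coneMetric p q ht).metricSpace.dist x y =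
      ((coneMetric p q ht).emetricSpace.edist x y).toReal := rfl
  rw [hd, dist_toHemisphere]
  have htop := (coneMetric p q ht).edist_ne_top x y
  have h1 := edist_coneMetric_le ht ht1 hq x y
  have h2 := angle_flatten_le_edist_coneMetric ht x y
  have ha := InnerProductGeometry.angle_nonneg (flatten (x : SplitSpace p q))
    (flatten (y : SplitSpace p q))
  have hpos : 0 ≤ √t * Real.pi := by positivity
  have harc := Real.arccos_nonneg (√(1 + t))⁻¹
  rw [← ENNReal.ofReal_add hpos ha] at h1
  have h3 := ENNReal.toReal_le_of_le_ofReal (add_nonneg hpos ha) h1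
  have h4 := (ENNReal.ofReal_le_iff_le_toReal htop).1 h2
  rw [abs_le]
  constructor <;> linarith

end Hemisphere

/-! ### Gromov–Hausdorff convergence -/

theorem dist_toGHSpace_le_of_surjective {X Y : Type} [MetricSpace X] [CompactSpace X] [Nonempty X]
    [MetricSpace Y] [CompactSpace Y] [Nonempty Y] {Φ : X → Y} (hΦ : Function.Surjective Φ) {ε : ℝ}
    (h : ∀ x y, |dist x y - dist (Φ x) (Φ y)| ≤ ε) :
    dist (GromovHausdorff.toGHSpace X) (GromovHausdorff.toGHSpace Y) ≤ ε / 2 := by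
  -- The whole space is its own `0`-net and the image is everything, so only half the distortion
  -- remains.
  have h1 := GromovHausdorff.ghDist_le_of_approx_subsets (s := univ) (fun x : (univ : Set X) ↦ Φ x)
    (ε₁ := 0) (ε₂ := ε) (ε₃ := 0) (fun x ↦ ⟨x, mem_univ x, (dist_self x).le⟩)
    (fun y ↦ by
      obtain ⟨x, rfl⟩ := hΦ y
      exact ⟨⟨x, mem_univ x⟩, (dist_self _).le⟩)
    (fun x y ↦ h x y)
  simpa [GromovHausdorff.ghDist] using h1

theorem dist_toGHSpace_coneMetric_le {p q : ℕ} [Fact (2 ≤ p)] (hq : 2 ≤ q) {t : ℝ} (ht : 0 < t)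
    (ht1 : t ≤ 1) :
    dist (coneMetric p q ht).toGHSpace (GromovHausdorff.toGHSpace (Hemisphere p)) ≤
      (√t * Real.pi + 2 * Real.arccos (√(1 + t))⁻¹) / 2 := by
  -- Compactness is recorded for the original topology before the Riemannian distance becomes the
  -- instance; the two topologies agree by definition.
  have hcomp : CompactSpace (SplitSphere p q) := inferInstance
  let := (coneMetric p q ht).metricSpace
  have : CompactSpace (SplitSphere p q) := hcomp
  exact dist_toGHSpace_le_of_surjective (toHemisphere_surjective hq)
    (abs_dist_coneMetric_sub_le ht ht1 hq)

end

theorem theorem3p1 (p q : ℕ) [Fact (2 ≤ p)] [Fact (2 ≤ q)] :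
    ∃ h : ℝ → SmoothMetric (EuclideanSpace ℝ (Fin (p + q - 1))) (SplitSphere p q),
      SmoothMetric.ContinuousFamilyOn h (Set.Ioc 0 1) ∧
      (∀ t ∈ Set.Ioc (0 : ℝ) 1,
        ∀ (A : EuclideanSpace ℝ (Fin p) ≃ₗᵢ[ℝ] EuclideanSpace ℝ (Fin p))
          (B : EuclideanSpace ℝ (Fin q) ≃ₗᵢ[ℝ] EuclideanSpace ℝ (Fin q)),
          (h t).IsPreservedBy (splitAction A B)) ∧
      (∀ t ∈ Set.Ioc (0 : ℝ) 1, (h t).CurvatureOperatorGE 1) ∧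
      Tendsto (fun t ↦ (h t).toGHSpace) (𝓝[>] 0)
        (𝓝 (GromovHausdorff.toGHSpace (Hemisphere p))) := by
  have hq : 2 ≤ q := Fact.out
  refine ⟨coneFamily p q, continuousFamilyOn_coneFamily, fun t ht A B ↦ ?_, fun t ht ↦ ?_, ?_⟩
  · rw [coneFamily_of_pos ht.1]
    exact isPreservedBy_coneMetric ht.1 A B
  · rw [coneFamily_of_pos ht.1]
    exact curvatureOperatorGE_coneMetric ht.1
  · rw [tendsto_iff_dist_tendsto_zero]
    -- The bound is continuous at `0`, with value `0` because `arccos 1 = 0`.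
    have hlim : Tendsto (fun t : ℝ ↦ (√t * Real.pi + 2 * Real.arccos (√(1 + t))⁻¹) / 2)
        (𝓝[>] 0) (𝓝 0) := by
      have hc : ContinuousAt (fun t : ℝ ↦ (√t * Real.pi + 2 * Real.arccos (√(1 + t))⁻¹) / 2) 0 := by
        have h1 : ContinuousAt (fun t : ℝ ↦ (√(1 + t))⁻¹) 0 :=
          (Real.continuous_sqrt.comp (continuous_const.add continuous_id)).continuousAt.inv₀
            (by simp)
        exact (((Real.continuous_sqrt.continuousAt).mul continuousAt_const).add
          (continuousAt_const.mul (Real.continuous_arccos.continuousAt.comp h1))).div_const 2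
      have h := hc.tendsto.mono_left (nhdsWithin_le_nhds (s := Ioi 0))
      simpa using h
    refine squeeze_zero' (Eventually.of_forall fun t ↦ dist_nonneg) ?_ hlim
    filter_upwards [Ioc_mem_nhdsGT (zero_lt_one (α := ℝ))] with t ht
    rw [coneFamily_of_pos ht.1]
    exact dist_toGHSpace_coneMetric_le hq ht.1 ht.2
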